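/- For a compact set \(K\subset\mathbb{R}^2\) and a point \(x\in\mathbb{R}^2\), let \[K_x=\{u\in K : [x,u]\cap K=\{u\}\}\] be the part of \(K\) visible from \(x\), where \([x,u]\) denotes the closed line segment joining \(x\) to \(u\), and let \(\dim_H\) denote Hausdorff dimension. If \(\Gamma\subset\mathbb{R}^2\) is a compact connected set with \(\dim_H\Gamma>1\), then for Lebesgue-almost every \(x\in\mathbb{R}^2\), \[\dim_H(\Gamma_x)\le \frac12+\sqrt{\dim_H\Gamma-\frac34}.\] -/

import Mathlib

/-- The part of `K ⊆ ℝ²` visible from `x`: the points `u ∈ K` such that the closed line segment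
`[x, u]` meets `K` only at `u`. -/
def visiblePart (K : Set (EuclideanSpace ℝ (Fin 2))) (x : EuclideanSpace ℝ (Fin 2)) :
    Set (EuclideanSpace ℝ (Fin 2)) :=
  {u | u ∈ K ∧ segment ℝ x u ∩ K = {u}}

/-! With `s = dimH Γ`, the proof gives the stronger bound `(s + 1) / 2`; it implies the stated one
because `(s - 1) * (s - 3) ≤ 0` for `1 ≤ s ≤ 2`.

Take viewpoints in a small box free of `Γ` and look at the part of `Γ` lying higher up. Two
viewpoints at distance `δ` on a horizontal line can both see only `O(1 / (r * δ))` grid squares of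
size `r` (`exists_card_common_sight_le`): certain triples of squares would enclose a piece of the
connected set `Γ` in a triangle that `Γ` cannot leave (`false_of_crossing_sightlines`), and a planar
lattice configuration without such triples has linear size
(`card_le_of_no_dominated_decreasing_pair`).

Integrating this count over pairs of viewpoints bounds the sum over squares of the squared length of
the viewpoints seeing each square, by about `r ^ (-1 - ε)` (`exists_sum_sq_volume_le`). Now cover
`Γ` efficiently by dyadic squares and retain, for each viewpoint, only the squares it sees. For `t`
slightly above `(s + 1) / 2` the expected `t`-dimensional content of the retained cover tends to
zero, so Fatou's lemma makes almost every visible part `μH[t]`-null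
(`ae_openBox_hausdorffMeasure_visiblePart_eq_zero`). Countably many boxes and four directions then
exhaust all viewpoints off `Γ`. -/

/-! ### Counting planar lattice configurations -/

theorem Finset.card_le_of_forall_lt_add {α : Type*} (F : Finset α) (f : α → ℤ) (g : ℕ)
    (hinj : Set.InjOn f F) (h : ∀ p ∈ F, ∀ q ∈ F, f q < f p + g) : F.card ≤ g := by
  rcases F.eq_empty_or_nonempty with rfl | hF
  · simp
  · obtain ⟨p, hp, hmin⟩ := F.exists_min_image f hF
    have hsub : F.image f ⊆ Finset.Ico (f p) (f p + g) := by
      intro z hz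
      obtain ⟨q, hq, rfl⟩ := Finset.mem_image.1 hz
      exact Finset.mem_Ico.2 ⟨hmin q hq, h p hp q hq⟩
    have := Finset.card_le_card hsub
    rw [Finset.card_image_of_injOn hinj, Int.card_Ico] at this
    simpa using this

theorem Finset.card_le_of_fibers_lt_add {α : Type*} [DecidableEq α] (F : Finset α)
    (key f : α → ℤ) (g n : ℕ) (hkey : ∀ p ∈ F, key p ∈ Finset.Icc (-n : ℤ) n)
    (hinj : ∀ p ∈ F, ∀ q ∈ F, key p = key q → f p = f q → p = q)
    (h : ∀ p ∈ F, ∀ q ∈ F, key p = key q → f q < f p + g) : F.card ≤ g * (2 * n + 1) := by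
  have h1 : F.card ≤ g * (F.image key).card := by
    refine Finset.card_le_mul_card_image F g fun b _ => ?_
    refine Finset.card_le_of_forall_lt_add _ f g ?_ ?_
    · intro p hp q hq hpq
      simp only [Finset.coe_filter, Set.mem_ofPred_eq] at hp hq
      exact hinj p hp.1 q hq.1 (hp.2.trans hq.2.symm) hpq
    · intro p hp q hq
      simp only [Finset.mem_filter] at hp hq
      exact h p hp.1 q hq.1 (hp.2.trans hq.2.symm)
  have h2 : (F.image key).card ≤ 2 * n + 1 := by
    have : F.image key ⊆ Finset.Icc (-n : ℤ) n := by
      intro z hz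
      obtain ⟨q, hq, rfl⟩ := Finset.mem_image.1 hz
      exact hkey q hq
    have := Finset.card_le_card this
    rw [Int.card_Icc] at this
    omega
  exact h1.trans (Nat.mul_le_mul_left g h2)

/-- A finite planar integer configuration in which no point lies well below both members of a
decreasing pair has at most linearly many points. -/
theorem card_le_of_no_dominated_decreasing_pair (O : Finset (ℤ × ℤ)) (g n : ℕ)
    (hO : ∀ p ∈ O, p.1 ∈ Finset.Icc (-n : ℤ) n ∧ p.2 ∈ Finset.Icc (-n : ℤ) n)
    (h : ∀ v ∈ O, ∀ u ∈ O, ∀ w ∈ O, v.1 + g ≤ w.1 → w.1 + g ≤ u.1 →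
      v.2 + g ≤ u.2 → u.2 + g ≤ w.2 → False) :
    O.card ≤ g * (8 * n + 3) := by
  classical
  set R := O.filter fun p => ∀ q ∈ O, q.2 = p.2 → q.1 < p.1 + g with hR
  set C := O.filter fun p => ∀ q ∈ O, q.1 = p.1 → q.2 < p.2 + g with hC
  -- `R` has at most `g` points per row and `C` at most `g` per column. A point of `D` has a
  -- companion far to its right and one far above it; these form a decreasing pair, so `D` has at
  -- most `g` points per diagonal.
  set D := O.filter fun p => (∃ q ∈ O, q.2 = p.2 ∧ p.1 + g ≤ q.1) ∧
    (∃ q ∈ O, q.1 = p.1 ∧ p.2 + g ≤ q.2) with hD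
  have hcov : O ⊆ R ∪ C ∪ D := by
    intro p hp
    simp only [hR, hC, hD, Finset.mem_union, Finset.mem_filter]
    by_cases h1 : ∀ q ∈ O, q.2 = p.2 → q.1 < p.1 + g
    · exact Or.inl (Or.inl ⟨hp, h1⟩)
    · by_cases h2 : ∀ q ∈ O, q.1 = p.1 → q.2 < p.2 + g
      · exact Or.inl (Or.inr ⟨hp, h2⟩)
      · push Not at h1 h2
        exact Or.inr ⟨hp, h1, h2⟩
  have cR : R.card ≤ g * (2 * n + 1) := by
    refine Finset.card_le_of_fibers_lt_add R Prod.snd Prod.fst g n ?_ ?_ ?_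
    · exact fun p hp => (hO p (Finset.mem_filter.1 hp).1).2
    · exact fun p _ q _ h1 h2 => Prod.ext h2 h1
    · exact fun p hp q hq hpq => (Finset.mem_filter.1 hp).2 q (Finset.mem_filter.1 hq).1 hpq.symm
  have cC : C.card ≤ g * (2 * n + 1) := by
    refine Finset.card_le_of_fibers_lt_add C Prod.fst Prod.snd g n ?_ ?_ ?_
    · exact fun p hp => (hO p (Finset.mem_filter.1 hp).1).1
    · exact fun p _ q _ h1 h2 => Prod.ext h1 h2
    · exact fun p hp q hq hpq => (Finset.mem_filter.1 hp).2 q (Finset.mem_filter.1 hq).1 hpq.symm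
  have cD : D.card ≤ g * (2 * (2 * n) + 1) := by
    refine Finset.card_le_of_fibers_lt_add D (fun p => p.1 - p.2) Prod.fst g (2 * n) ?_ ?_ ?_
    · intro p hp
      have := hO p (Finset.mem_filter.1 hp).1
      simp only [Finset.mem_Icc] at this ⊢
      push_cast
      constructor <;> linarith [this.1.1, this.1.2, this.2.1, this.2.2]
    · intro p _ q _ h1 h2
      exact Prod.ext h2 (by omega)
    · intro p hp q hq hpq
      by_contra hcon
      push Not at hcon
      obtain ⟨hq0, ⟨u, hu, hu2, hu1⟩, ⟨w, hw, hw1, hw2⟩⟩ := Finset.mem_filter.1 hq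
      have hp0 := (Finset.mem_filter.1 hp).1
      exact h p hp0 u hu w hw (by omega) (by omega) (by omega) (by omega)
  have := Finset.card_le_card hcov
  have h3 := Finset.card_union_le (R ∪ C) D
  have h4 := Finset.card_union_le R C
  have : O.card ≤ g * (2 * n + 1) + g * (2 * n + 1) + g * (2 * (2 * n) + 1) := by omega
  refine this.trans (le_of_eq ?_)
  ring

/-! ### Crossing lines of sight -/

/-- The horizontal slope at which `p` is seen from `(a, h)`. -/
noncomputable def slopeFrom (a h : ℝ) (p : EuclideanSpace ℝ (Fin 2)) : ℝ := (p 0 - a) / (p 1 - h)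

theorem mem_segment_of_slopeFrom_eq {a h : ℝ} {p u : EuclideanSpace ℝ (Fin 2)} (hp : h < p 1)
    (hpu : p 1 ≤ u 1) (hs : slopeFrom a h p = slopeFrom a h u) :
    p ∈ segment ℝ (!₂[a, h] : EuclideanSpace ℝ (Fin 2)) u := by
  have hp' : 0 < p 1 - h := by linarith
  have hu' : 0 < u 1 - h := by linarith
  rw [segment_eq_image]
  refine ⟨(p 1 - h) / (u 1 - h), ⟨by positivity, (div_le_one hu').2 (by linarith)⟩, ?_⟩
  unfold slopeFrom at hs
  rw [div_eq_div_iff hp'.ne' hu'.ne'] at hs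
  ext i
  fin_cases i
  · simp
    field_simp
    linear_combination -hs
  · simp
    field_simp
    ring

/-- Two crossing lines of sight from `(a, h)` and `(b, h)` bound, together with the segment joining
the two viewpoints, a triangle that a connected set reaching beyond it cannot meet. -/
theorem false_of_crossing_sightlines {Γ : Set (EuclideanSpace ℝ (Fin 2))} (hΓ : IsPreconnected Γ)
    {a b h : ℝ} (hab : a < b) {N₁ N₂ : Set (EuclideanSpace ℝ (Fin 2))}
    {u₁ u₂ v w : EuclideanSpace ℝ (Fin 2)}
    (hbase : ∀ p ∈ Γ, p 1 = h → a ≤ p 0 → p 0 ≤ b → False)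
    (hu₁ : u₁ ∈ N₁) (hs₁ : segment ℝ (!₂[b, h] : EuclideanSpace ℝ (Fin 2)) u₁ ∩ Γ ⊆ N₁)
    (hs₂ : segment ℝ (!₂[a, h] : EuclideanSpace ℝ (Fin 2)) u₂ ∩ Γ ⊆ N₂)
    (hh₁ : h < u₁ 1) (hh₂ : h < u₂ 1) (hu₂ : u₂ ∈ N₂)
    (h₁ : ∀ p ∈ N₁, slopeFrom a h p < slopeFrom a h u₂)
    (h₂ : ∀ p ∈ N₂, slopeFrom b h u₁ < slopeFrom b h p)
    (hv : v ∈ Γ) (hv1 : h < v 1) (hva : slopeFrom a h u₂ < slopeFrom a h v)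
    (hvb : slopeFrom b h v < slopeFrom b h u₁) (hw : w ∈ Γ) (hwN : w ∈ N₂) (hw1 : h < w 1) :
    False := by
  set A := slopeFrom a h u₂ with hA
  set B := slopeFrom b h u₁ with hB
  have key : ∀ p : EuclideanSpace ℝ (Fin 2), h < p 1 →
      slopeFrom a h p = slopeFrom b h p + (b - a) / (p 1 - h) := by
    intro p hp
    unfold slopeFrom
    rw [← add_div]
    ring
  have mono : ∀ p q : EuclideanSpace ℝ (Fin 2), h < p 1 → h < q 1 →
      (b - a) / (q 1 - h) ≤ (b - a) / (p 1 - h) → p 1 ≤ q 1 := by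
    intro p q hp hq hle
    rw [div_le_div_iff_of_pos_left (by linarith) (by linarith) (by linarith)] at hle
    linarith
  -- `W` is the open triangle below the crossing point of the two sightlines and `V` the closed one.
  -- `Γ` avoids `V \ W`, while `v` lies in `W` and `w` outside `V`.
  let W : Set (EuclideanSpace ℝ (Fin 2)) :=
    {p | h < p 1} ∩ ({p | A * (p 1 - h) < p 0 - a} ∩ {p | p 0 - b < B * (p 1 - h)})
  let V : Set (EuclideanSpace ℝ (Fin 2)) :=
    {p | h ≤ p 1} ∩ ({p | A * (p 1 - h) ≤ p 0 - a} ∩ {p | p 0 - b ≤ B * (p 1 - h)})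
  have c1 : Continuous fun p : EuclideanSpace ℝ (Fin 2) => p 1 := by fun_prop
  have hW : IsOpen W := by
    refine (isOpen_lt continuous_const c1).inter ((isOpen_lt ?_ ?_).inter (isOpen_lt ?_ ?_)) <;>
      fun_prop
  have hV : IsClosed V := by
    refine (isClosed_le continuous_const c1).inter
      ((isClosed_le ?_ ?_).inter (isClosed_le ?_ ?_)) <;> fun_prop
  have hsub : Γ ⊆ W ∪ Vᶜ := by
    intro p hp
    by_contra hcon
    simp only [Set.mem_union, Set.mem_compl_iff, not_or, not_not] at hcon
    obtain ⟨hnW, hp1, hpa, hpb⟩ := hcon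
    change h ≤ p 1 at hp1
    change A * (p 1 - h) ≤ p 0 - a at hpa
    change p 0 - b ≤ B * (p 1 - h) at hpb
    rcases hp1.eq_or_lt with heq | hlt
    · rw [← heq] at hpa hpb
      exact hbase p hp heq.symm (by linarith) (by linarith)
    · have hpos : 0 < p 1 - h := by linarith
      have ha' : A ≤ slopeFrom a h p := (le_div_iff₀ hpos).2 hpa
      have hb' : slopeFrom b h p ≤ B := (div_le_iff₀ hpos).2 hpb
      have hor : slopeFrom a h p = A ∨ slopeFrom b h p = B := by
        by_contra hne
        push Not at hne
        refine hnW ⟨hlt, ?_, ?_⟩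
        · exact (lt_div_iff₀ hpos).1 (lt_of_le_of_ne ha' (Ne.symm hne.1))
        · exact (div_lt_iff₀ hpos).1 (lt_of_le_of_ne hb' hne.2)
      -- A point of `Γ` on a side of the triangle is no higher than the target of that sightline, so
      -- it lies on the segment and hence in `N₂` or `N₁`. Those sets lie strictly beyond the other
      -- sightline.
      rcases hor with hpA | hpB
      · have hle : p 1 ≤ u₂ 1 := by
          refine mono p u₂ hlt hh₂ ?_
          have e1 := key p hlt
          have e2 := key u₂ hh₂
          have e3 := h₂ u₂ hu₂
          linarith
        have := h₂ p (hs₂ ⟨mem_segment_of_slopeFrom_eq hlt hle hpA, hp⟩)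
        linarith
      · have hle : p 1 ≤ u₁ 1 := by
          refine mono p u₁ hlt hh₁ ?_
          have e1 := key p hlt
          have e2 := key u₁ hh₁
          have e3 := h₁ u₁ hu₁
          linarith
        have := h₁ p (hs₁ ⟨mem_segment_of_slopeFrom_eq hlt hle hpB, hp⟩)
        linarith
  obtain ⟨p, -, hpW, hpV⟩ := hΓ W Vᶜ hW hV.isOpen_compl hsub
    ⟨v, hv, hv1, (lt_div_iff₀ (by linarith)).1 hva, (div_lt_iff₀ (by linarith)).1 hvb⟩
    ⟨w, hw, fun hwV => absurd ((div_le_iff₀ (by linarith)).2 hwV.2.2) (not_le.2 (h₂ w hwN))⟩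
  exact hpV ⟨le_of_lt (show h < p 1 from hpW.1),
    le_of_lt (show A * (p 1 - h) < p 0 - a from hpW.2.1),
    le_of_lt (show p 0 - b < B * (p 1 - h) from hpW.2.2)⟩

/-! ### Counting grid squares in sight of two viewpoints -/

/-- The open square of half-side `r` about the lattice point `r • m`. -/
def gridSquare (r : ℝ) (m : ℤ × ℤ) : Set (EuclideanSpace ℝ (Fin 2)) :=
  {p | |p 0 - r * m.1| < r ∧ |p 1 - r * m.2| < r}

/-- The viewpoints from which some point of `N` can be reached by a segment meeting `Γ` only
inside `N`. -/
def sightSet (Γ N : Set (EuclideanSpace ℝ (Fin 2))) : Set (EuclideanSpace ℝ (Fin 2)) :=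
  {x | ∃ u ∈ N, segment ℝ x u ∩ Γ ⊆ N}

theorem center_mem_gridSquare {r : ℝ} (hr : 0 < r) (m : ℤ × ℤ) :
    (!₂[r * m.1, r * m.2] : EuclideanSpace ℝ (Fin 2)) ∈ gridSquare r m := by
  simp [gridSquare, hr]

theorem abs_slopeFrom_sub_le {a h c R ρ : ℝ} (hc : 0 < c) {p q : EuclideanSpace ℝ (Fin 2)}
    (hp : c ≤ p 1 - h) (hq : c ≤ q 1 - h) (h0 : |p 0 - q 0| ≤ ρ) (h1 : |p 1 - q 1| ≤ ρ)
    (hR : |q 0 - a| ≤ R) :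
    |slopeFrom a h p - slopeFrom a h q| ≤ (1 / c + R / c ^ 2) * ρ := by
  have hp' : 0 < p 1 - h := by linarith
  have hq' : 0 < q 1 - h := by linarith
  have hρ : 0 ≤ ρ := (abs_nonneg _).trans h0
  have hR0 : 0 ≤ R := (abs_nonneg _).trans hR
  have e : slopeFrom a h p - slopeFrom a h q =
      (p 0 - q 0) / (p 1 - h) - (q 0 - a) * (p 1 - q 1) / ((p 1 - h) * (q 1 - h)) := by
    unfold slopeFrom
    field_simp
    ring
  have b1 : |(p 0 - q 0) / (p 1 - h)| ≤ ρ / c := by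
    rw [abs_div, abs_of_pos hp']
    exact div_le_div₀ hρ h0 hc hp
  have b2 : |(q 0 - a) * (p 1 - q 1) / ((p 1 - h) * (q 1 - h))| ≤ R * ρ / (c * c) := by
    rw [abs_div, abs_mul, abs_of_pos (mul_pos hp' hq')]
    exact div_le_div₀ (by positivity) (mul_le_mul hR h1 (abs_nonneg _) hR0) (by positivity)
      (mul_le_mul hp hq hc.le hp'.le)
  rw [e]
  refine (abs_sub _ _).trans ((add_le_add b1 b2).trans (le_of_eq ?_))
  field_simp

theorem floor_mem_Icc_of_abs_le {z : ℝ} {n : ℕ} (h : |z| ≤ n) :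
    ⌊z⌋ ∈ Finset.Icc (-n : ℤ) n := by
  obtain ⟨h1, h2⟩ := abs_le.1 h
  rw [Finset.mem_Icc]
  constructor
  · rw [Int.le_floor]
    push_cast
    exact h1
  · exact_mod_cast (Int.floor_le z).trans h2

/-- If two values have scaled floors at least `3` apart, then perturbing each of them by at most
one unit of scale keeps them in order. -/
theorem lt_of_floor_add_three_le {z z' w w' ε : ℝ} (hε : 0 < ε) (hzw : |w - z| ≤ ε)
    (hzw' : |w' - z'| ≤ ε) (h : ⌊z / ε⌋ + 3 ≤ ⌊z' / ε⌋) : w < w' := by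
  have h1 := Int.lt_floor_add_one (z / ε)
  have h2 := Int.floor_le (z' / ε)
  have h3 : (⌊z / ε⌋ : ℝ) + 3 ≤ ⌊z' / ε⌋ := by exact_mod_cast h
  have h4 : z / ε + 2 < z' / ε := by linarith
  have h5 : z + 2 * ε < z' := by
    have := mul_lt_mul_of_pos_right h4 hε
    rwa [add_mul, div_mul_cancel₀ _ hε.ne', div_mul_cancel₀ _ hε.ne'] at this
  have := (abs_le.1 hzw).2
  have := (abs_le.1 hzw').1
  linarith

theorem abs_sub_lt_of_floor_div_eq {z z' ε : ℝ} (hε : 0 < ε) (h : ⌊z / ε⌋ = ⌊z' / ε⌋) :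
    |z - z'| < ε := by
  have := Int.abs_sub_lt_one_of_floor_eq_floor h
  rwa [← sub_div, abs_div, abs_of_pos hε, div_lt_one hε] at this

/-- The number of grid squares in sight of both `(a, h)` and `(b, h)`. -/
theorem exists_card_common_sight_le {c R : ℝ} (hc : 0 < c) (hR : 0 < R) :
    ∃ C : ℝ, 0 < C ∧ ∀ (Γ : Set (EuclideanSpace ℝ (Fin 2))), IsPreconnected Γ →
      ∀ (a b h r : ℝ), 0 < r → r ≤ 1 → a < b → b - a ≤ 1 → |a| ≤ R → |b| ≤ R →
      (∀ p ∈ Γ, p 1 = h → a ≤ p 0 → p 0 ≤ b → False) →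
      ∀ M : Finset (ℤ × ℤ),
      (∀ m ∈ M, (Γ ∩ gridSquare r m).Nonempty) →
      (∀ m ∈ M, ∀ p ∈ gridSquare r m, c ≤ p 1 - h ∧ p 1 - h ≤ R ∧ |p 0| ≤ R) →
      (∀ m ∈ M, (!₂[a, h] : EuclideanSpace ℝ (Fin 2)) ∈ sightSet Γ (gridSquare r m)) →
      (∀ m ∈ M, (!₂[b, h] : EuclideanSpace ℝ (Fin 2)) ∈ sightSet Γ (gridSquare r m)) →
      (M.card : ℝ) ≤ C / (r * (b - a)) := by
  classical
  obtain ⟨L, hL⟩ : ∃ L, L = 1 / c + 2 * R / c ^ 2 := ⟨_, rfl⟩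
  have hL0 : 0 < L := by rw [hL]; positivity
  -- The factors control the squares per row of a cell, the rows per cell (times `b - a`), and the
  -- number of cells (times `r`). `L` is a Lipschitz constant for the slopes, so a slope varies by
  -- at most `ε = L * r` from the centre of a square.
  refine ⟨(L * R + 1) * (2 * L * R ^ 2 + 1) * (3 * (16 * R / (c * L) + 19)), by positivity, ?_⟩
  intro Γ hΓ a b h r hr hr1 hab hab1 ha hb hbase M hne hbox hsa hsb
  have hδ : 0 < b - a := by linarith
  set ε := L * r with hε
  have hε0 : 0 < ε := by positivity
  let ctr : ℤ × ℤ → EuclideanSpace ℝ (Fin 2) := fun m => !₂[r * m.1, r * m.2]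
  have hctr : ∀ m, ctr m ∈ gridSquare r m := fun m => center_mem_gridSquare hr m
  have ctr0 : ∀ m, ctr m 0 = r * m.1 := fun m => by simp [ctr]
  have ctr1 : ∀ m, ctr m 1 = r * m.2 := fun m => by simp [ctr]
  have near : ∀ e, |e| ≤ R → ∀ m ∈ M, ∀ p ∈ gridSquare r m,
      |slopeFrom e h p - slopeFrom e h (ctr m)| ≤ ε := by
    intro e he m hm p hp
    have := abs_slopeFrom_sub_le (a := e) (R := 2 * R) (ρ := r) hc (hbox m hm p hp).1
      (hbox m hm _ (hctr m)).1 (by rw [ctr0]; exact hp.1.le) (by rw [ctr1]; exact hp.2.le)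
      ((abs_sub _ _).trans (by linarith [(hbox m hm _ (hctr m)).2.2]))
    rwa [← hL] at this
  have size : ∀ e, |e| ≤ R → ∀ m ∈ M, |slopeFrom e h (ctr m) / ε| ≤ 2 * R / (c * ε) := by
    intro e he m hm
    have hb1 := hbox m hm _ (hctr m)
    unfold slopeFrom
    rw [div_div, abs_div, abs_of_pos (mul_pos (by linarith) hε0)]
    refine div_le_div₀ (by positivity) ((abs_sub _ _).trans (by linarith)) (by positivity) ?_
    exact mul_le_mul_of_nonneg_right hb1.1 hε0.le
  -- The sign on the first slope turns the forbidden triangle into the dominated decreasing pair of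
  -- the lattice count.
  let cell : ℤ × ℤ → ℤ × ℤ := fun m =>
    (⌊-slopeFrom a h (ctr m) / ε⌋, ⌊slopeFrom b h (ctr m) / ε⌋)
  set n : ℕ := ⌈2 * R / (c * ε)⌉₊ with hn
  have hnle : 2 * R / (c * ε) ≤ n := Nat.le_ceil _
  have hcells : (M.image cell).card ≤ 3 * (8 * n + 3) := by
    refine card_le_of_no_dominated_decreasing_pair _ 3 n ?_ ?_
    · intro q hq
      obtain ⟨m, hm, rfl⟩ := Finset.mem_image.1 hq
      refine ⟨floor_mem_Icc_of_abs_le ?_, floor_mem_Icc_of_abs_le ?_⟩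
      · rw [neg_div, abs_neg]
        exact (size a ha m hm).trans hnle
      · exact (size b hb m hm).trans hnle
    · intro v hv u hu w hw hvw hwu hvu huw
      obtain ⟨v, hvM, rfl⟩ := Finset.mem_image.1 hv
      obtain ⟨u, huM, rfl⟩ := Finset.mem_image.1 hu
      obtain ⟨w, hwM, rfl⟩ := Finset.mem_image.1 hw
      have ordA : ∀ m ∈ M, ∀ m' ∈ M, (cell m).1 + 3 ≤ (cell m').1 → ∀ p ∈ gridSquare r m,
          ∀ p' ∈ gridSquare r m', slopeFrom a h p' < slopeFrom a h p := by
        intro m hm m' hm' hmm p hp p' hp'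
        have := lt_of_floor_add_three_le (w := -slopeFrom a h p) (w' := -slopeFrom a h p') hε0
          (by rw [← neg_sub', abs_neg]; exact near a ha m hm p hp)
          (by rw [← neg_sub', abs_neg]; exact near a ha m' hm' p' hp') hmm
        linarith
      have ordB : ∀ m ∈ M, ∀ m' ∈ M, (cell m).2 + 3 ≤ (cell m').2 → ∀ p ∈ gridSquare r m,
          ∀ p' ∈ gridSquare r m', slopeFrom b h p < slopeFrom b h p' :=
        fun m hm m' hm' hmm p hp p' hp' =>
          lt_of_floor_add_three_le hε0 (near b hb m hm p hp) (near b hb m' hm' p' hp') hmm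
      have above : ∀ m ∈ M, ∀ p ∈ gridSquare r m, h < p 1 :=
        fun m hm p hp => by linarith [(hbox m hm p hp).1]
      obtain ⟨u₁, hu₁, hs₁⟩ := hsb u huM
      obtain ⟨u₂, hu₂, hs₂⟩ := hsa w hwM
      obtain ⟨v₀, hv₀, hv₀N⟩ := hne v hvM
      obtain ⟨w₀, hw₀, hw₀N⟩ := hne w hwM
      exact false_of_crossing_sightlines hΓ hab hbase hu₁ hs₁ hs₂ (above u huM _ hu₁)
        (above w hwM _ hu₂) hu₂ (fun p hp => ordA w hwM u huM hwu _ hu₂ _ hp)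
        (fun p hp => ordB u huM w hwM huw _ hu₁ _ hp) hv₀ (above v hvM _ hv₀N)
        (ordA v hvM w hwM hvw _ hv₀N _ hu₂) (ordB v hvM u huM hvu _ hv₀N _ hu₁) hw₀ hw₀N
        (above w hwM _ hw₀N)
  set g₁ : ℕ := ⌈L * R⌉₊ with hg₁
  set g₂ : ℕ := ⌈2 * L * R ^ 2 / (b - a)⌉₊ with hg₂
  have hfib : M.card ≤ (g₁ * g₂) * (M.image cell).card := by
    refine Finset.card_le_mul_card_image M _ fun q _ => ?_
    have fibA : ∀ m ∈ M, ∀ m' ∈ M, cell m = cell m' →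
        |slopeFrom a h (ctr m) - slopeFrom a h (ctr m')| < ε := by
      intro m hm m' hm' he
      have := abs_sub_lt_of_floor_div_eq hε0 (congrArg Prod.fst he)
      rwa [← neg_sub', abs_neg] at this
    have fibB : ∀ m ∈ M, ∀ m' ∈ M, cell m = cell m' →
        |slopeFrom b h (ctr m) - slopeFrom b h (ctr m')| < ε :=
      fun m hm m' hm' he => abs_sub_lt_of_floor_div_eq hε0 (congrArg Prod.snd he)
    -- The two slopes differ by `(b - a) / (p 1 - h)`. Fixing both up to `ε` thus fixes the height
    -- up to a multiple of `r / (b - a)`; within one row, the slope from `a` fixes the abscissa up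
    -- to a multiple of `r`.
    have hcol : ((M.filter fun m => cell m = q).image Prod.snd).card ≤ g₂ := by
      refine Finset.card_le_of_forall_lt_add _ id g₂ (Function.injective_id.injOn) ?_
      intro z hz z' hz'
      obtain ⟨m, hm, rfl⟩ := Finset.mem_image.1 hz
      obtain ⟨m', hm', rfl⟩ := Finset.mem_image.1 hz'
      obtain ⟨hm, hmq⟩ := Finset.mem_filter.1 hm
      obtain ⟨hm', hmq'⟩ := Finset.mem_filter.1 hm'
      have hA := fibA m hm m' hm' (hmq.trans hmq'.symm)
      have hB := fibB m hm m' hm' (hmq.trans hmq'.symm)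
      obtain ⟨y1, y2, -⟩ := hbox m hm _ (hctr m)
      obtain ⟨y1', y2', -⟩ := hbox m' hm' _ (hctr m')
      have e : ∀ p : EuclideanSpace ℝ (Fin 2),
          slopeFrom a h p - slopeFrom b h p = (b - a) / (p 1 - h) := by
        intro p
        unfold slopeFrom
        rw [← sub_div]
        ring
      have d : |(b - a) / (ctr m 1 - h) - (b - a) / (ctr m' 1 - h)| < 2 * ε := by
        rw [← e, ← e]
        rw [abs_lt] at *
        constructor <;> linarith [hA.1, hA.2, hB.1, hB.2]
      have Y : 0 < ctr m 1 - h := by linarith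
      have Y' : 0 < ctr m' 1 - h := by linarith
      have d2 : (b - a) / (ctr m 1 - h) - (b - a) / (ctr m' 1 - h) =
          (b - a) * r * (m'.2 - m.2) / ((ctr m 1 - h) * (ctr m' 1 - h)) := by
        rw [div_sub_div _ _ Y.ne' Y'.ne', ctr1, ctr1]
        ring
      have d3 := (abs_lt.1 d).2
      rw [d2, div_lt_iff₀ (mul_pos Y Y')] at d3
      have d4 : (ctr m 1 - h) * (ctr m' 1 - h) ≤ R * R := mul_le_mul y2 y2' Y'.le hR.le
      have d5 : (b - a) * r * (m'.2 - m.2) < 2 * L * R ^ 2 * r := by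
        calc _ < _ := d3
          _ ≤ 2 * ε * (R * R) := by gcongr
          _ = _ := by rw [hε]; ring
      have d6 : (m'.2 - m.2 : ℝ) < 2 * L * R ^ 2 / (b - a) := by
        rw [lt_div_iff₀ hδ]
        have : (b - a) * r * (m'.2 - m.2) = ((m'.2 - m.2) * (b - a)) * r := by ring
        rw [this] at d5
        exact lt_of_mul_lt_mul_right d5 hr.le
      have d7 : (m'.2 - m.2 : ℝ) < g₂ := d6.trans_le (Nat.le_ceil _)
      have : m'.2 - m.2 < (g₂ : ℤ) := by exact_mod_cast d7
      simp only [id]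
      linarith
    refine (Finset.card_le_mul_card_image (f := Prod.snd) _ g₁ fun z _ => ?_).trans
      (Nat.mul_le_mul_left g₁ hcol)
    refine Finset.card_le_of_forall_lt_add _ Prod.fst g₁ ?_ ?_
    · intro m hm m' hm' hmm
      simp only [Finset.coe_filter, Set.mem_ofPred_eq] at hm hm'
      exact Prod.ext hmm (hm.2.trans hm'.2.symm)
    · intro m hm m' hm'
      simp only [Finset.mem_filter] at hm hm'
      have hA := fibA m hm.1.1 m' hm'.1.1 (hm.1.2.trans hm'.1.2.symm)
      obtain ⟨y1, y2, -⟩ := hbox m hm.1.1 _ (hctr m)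
      have hY : ctr m' 1 = ctr m 1 := by rw [ctr1, ctr1, hm.2, hm'.2]
      have Y : 0 < ctr m 1 - h := by linarith
      have d3 := (abs_lt.1 hA).1
      unfold slopeFrom at d3
      rw [hY, ← sub_div, ctr0, ctr0, lt_div_iff₀ Y] at d3
      have d4 : (m'.1 - m.1 : ℝ) * r < L * R * r := by
        have : ε * (ctr m 1 - h) ≤ ε * R := by gcongr
        have h5 : ε * R = L * R * r := by rw [hε]; ring
        linarith
      have d7 : (m'.1 - m.1 : ℝ) < g₁ := (lt_of_mul_lt_mul_right d4 hr.le).trans_le (Nat.le_ceil _)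
      have : m'.1 - m.1 < (g₁ : ℤ) := by exact_mod_cast d7
      linarith
  have hcard : M.card ≤ (g₁ * g₂) * (3 * (8 * n + 3)) :=
    hfib.trans (Nat.mul_le_mul_left _ hcells)
  have hcard' : (M.card : ℝ) ≤ (g₁ * g₂) * (3 * (8 * n + 3)) := by exact_mod_cast hcard
  have b₁ : (g₁ : ℝ) ≤ L * R + 1 := (Nat.ceil_lt_add_one (by positivity)).le
  have b₂ : (g₂ : ℝ) ≤ (2 * L * R ^ 2 + 1) / (b - a) := by
    refine (Nat.ceil_lt_add_one (by positivity)).le.trans ?_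
    rw [add_div]
    gcongr
    rw [le_div_iff₀ hδ]
    linarith
  have b₃ : (3 * (8 * n + 3) : ℝ) ≤ 3 * (16 * R / (c * L) + 19) / r := by
    have h1 : (n : ℝ) ≤ 2 * R / (c * ε) + 1 := (Nat.ceil_lt_add_one (by positivity)).le
    have h2 : (1 : ℝ) ≤ 1 / r := by rw [le_div_iff₀ hr]; linarith
    have h3 : 3 * (16 * R / (c * L) + 19) / r = 3 * (8 * (2 * R / (c * ε)) + 19 * (1 / r)) := by
      rw [hε]
      field_simp
      ring
    rw [h3]
    linarith
  calc (M.card : ℝ) ≤ (g₁ * g₂) * (3 * (8 * n + 3)) := hcard'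
    _ ≤ ((L * R + 1) * ((2 * L * R ^ 2 + 1) / (b - a))) *
        (3 * (16 * R / (c * L) + 19) / r) := by gcongr
    _ = _ := by field_simp

/-! ### Sight sets and grid squares -/

/-- For a fixed target, the blocked viewpoints are the projection of a closed set along the compact
parameter interval, hence closed. Openness supplies the measurability used in the integrals. -/
theorem isOpen_sightSet {Γ N : Set (EuclideanSpace ℝ (Fin 2))} (hΓ : IsClosed Γ) (hN : IsOpen N) :
    IsOpen (sightSet Γ N) := by
  have : sightSet Γ N = ⋃ u ∈ N, {x | segment ℝ x u ∩ Γ ⊆ N} := by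
    ext x
    simp [sightSet]
  rw [this]
  refine isOpen_biUnion fun u _ => ?_
  have hcl : IsClosed {z : EuclideanSpace ℝ (Fin 2) × Set.Icc (0 : ℝ) 1 |
      (1 - (z.2 : ℝ)) • z.1 + (z.2 : ℝ) • u ∈ Γ \ N} :=
    (hΓ.sdiff hN).preimage (by fun_prop)
  rw [← isClosed_compl_iff]
  convert isClosedMap_fst_of_compactSpace _ hcl using 1
  ext x
  simp only [Set.mem_compl_iff, Set.mem_ofPred_eq, Set.not_subset, segment_eq_image, Set.mem_image,
    Set.mem_inter_iff, Set.mem_sdiff]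
  constructor
  · rintro ⟨p, ⟨⟨θ, hθ, rfl⟩, hp⟩, hpN⟩
    exact ⟨(x, ⟨θ, hθ⟩), ⟨hp, hpN⟩, rfl⟩
  · rintro ⟨⟨x', θ, hθ⟩, ⟨hp, hpN⟩, rfl⟩
    exact ⟨_, ⟨⟨θ, hθ, rfl⟩, hp⟩, hpN⟩

theorem mem_sightSet_of_mem_visiblePart {Γ N : Set (EuclideanSpace ℝ (Fin 2))}
    {x u : EuclideanSpace ℝ (Fin 2)} (hu : u ∈ visiblePart Γ x) (huN : u ∈ N) :
    x ∈ sightSet Γ N :=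
  ⟨u, huN, by rw [hu.2]; simpa using huN⟩

theorem isOpen_gridSquare (r : ℝ) (m : ℤ × ℤ) : IsOpen (gridSquare r m) := by
  have : gridSquare r m = {p : EuclideanSpace ℝ (Fin 2) | |p 0 - r * m.1| < r} ∩
      {p | |p 1 - r * m.2| < r} := rfl
  rw [this]
  refine (isOpen_lt ?_ ?_).inter (isOpen_lt ?_ ?_) <;> fun_prop

theorem EuclideanSpace.dist_le_abs_add_abs (p q : EuclideanSpace ℝ (Fin 2)) :
    dist p q ≤ |p 0 - q 0| + |p 1 - q 1| := by
  rw [EuclideanSpace.dist_eq, Fin.sum_univ_two, Real.dist_eq, Real.dist_eq]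
  refine Real.sqrt_le_iff.2 ⟨by positivity, ?_⟩
  nlinarith [abs_nonneg (p 0 - q 0), abs_nonneg (p 1 - q 1)]

theorem ediam_gridSquare_le (r : ℝ) (m : ℤ × ℤ) :
    Metric.ediam (gridSquare r m) ≤ ENNReal.ofReal (4 * r) := by
  refine Metric.ediam_le fun p hp q hq => ?_
  rw [edist_dist]
  refine ENNReal.ofReal_le_ofReal ((EuclideanSpace.dist_le_abs_add_abs p q).trans ?_)
  obtain ⟨p0, p1⟩ := hp
  obtain ⟨q0, q1⟩ := hq
  rw [abs_lt] at p0 p1 q0 q1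
  have : |p 0 - q 0| ≤ 2 * r := abs_le.2 ⟨by linarith, by linarith⟩
  have : |p 1 - q 1| ≤ 2 * r := abs_le.2 ⟨by linarith, by linarith⟩
  linarith

/-! ### Second moments and horizontal slices -/

open MeasureTheory ENNReal

/-- The sum of squares is the integral over pairs `(x, y)` of the number of `A i` containing both
points. That number is at most `C / (r * |x - y|)` and at most `C / r ^ 2`; interpolating between
the two makes the singularity integrable at the cost of `r ^ (-ε)`. -/
theorem exists_sum_sq_volume_le {ε : ℝ} (hε : 0 < ε) (hε1 : ε ≤ 1) :
    ∃ K : ℝ≥0∞, K ≠ ⊤ ∧ ∀ {ι : Type} (M : Finset ι) (A : ι → Set ℝ) (a b C r : ℝ),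
      (∀ i ∈ M, MeasurableSet (A i)) → (∀ i ∈ M, A i ⊆ Set.Ioo a b) → b - a ≤ 1 → 0 < r → 0 < C →
      (∀ x ∈ Set.Ioo a b, ∀ y ∈ Set.Ioo a b, x < y → ∀ M' ⊆ M,
        (∀ i ∈ M', x ∈ A i) → (∀ i ∈ M', y ∈ A i) → (M'.card : ℝ) ≤ C / (r * (y - x))) →
      (M.card : ℝ) ≤ C / r ^ 2 →
      ∑ i ∈ M, volume (A i) ^ 2 ≤ K * ENNReal.ofReal (C * r ^ (-1 - ε)) := by
  let φ : ℝ → ℝ≥0∞ := (Metric.ball (0 : ℝ) 1).indicator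
    fun u => ENNReal.ofReal (|u| ^ (-(1 - ε)))
  have hφm : Measurable φ := by
    refine Measurable.indicator ?_ measurableSet_ball
    fun_prop
  refine ⟨∫⁻ u, φ u, ?_, ?_⟩
  · have hint : IntegrableOn (fun u : ℝ => |u| ^ (-(1 - ε))) (Metric.ball 0 1) := by
      refine integrableOn_ball_of_norm_le_rpow (C := 1) (α := 1 - ε) (by simp) (by simpa using hε)
        (Filter.Eventually.of_forall fun x => ?_) ?_
      · rw [Real.norm_eq_abs, Real.norm_eq_abs, one_mul, abs_of_nonneg (by positivity)]
      · exact Measurable.aestronglyMeasurable (by fun_prop)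
    rw [lintegral_indicator measurableSet_ball]
    exact (Integrable.lintegral_lt_top hint).ne
  intro ι M A a b C r hA hAI hab hr hC hpair hcard
  classical
  have bound : ∀ x y : ℝ, x < y → x ∈ Set.Ioo a b → y ∈ Set.Ioo a b → ∀ M' ⊆ M,
      (∀ i ∈ M', x ∈ A i) → (∀ i ∈ M', y ∈ A i) →
      (M'.card : ℝ≥0∞) ≤ ENNReal.ofReal (C * r ^ (-1 - ε)) * φ (y - x) := by
    intro x y hxy hx hy M' hM' h1 h2
    have hd : 0 < y - x := by linarith
    have hball : y - x ∈ Metric.ball (0 : ℝ) 1 := by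
      rw [mem_ball_zero_iff, Real.norm_eq_abs, abs_of_pos hd]
      linarith [hx.1, hy.2]
    simp only [φ, Set.indicator_of_mem hball]
    rw [← ENNReal.ofReal_mul (by positivity), ← ENNReal.ofReal_natCast, abs_of_pos hd]
    refine ENNReal.ofReal_le_ofReal ?_
    have c1 := hpair x hx y hy hxy M' hM' h1 h2
    have c2 : (M'.card : ℝ) ≤ C / r ^ 2 :=
      (Nat.cast_le.2 (Finset.card_le_card hM')).trans hcard
    have e1 : r ^ (-1 - ε) = r⁻¹ * r⁻¹ ^ ε := by
      rw [Real.rpow_sub hr, Real.rpow_neg_one, Real.inv_rpow hr.le]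
      rfl
    have e2 : (y - x) ^ (-(1 - ε)) = (y - x)⁻¹ ^ (1 - ε) := by
      rw [Real.rpow_neg hd.le, Real.inv_rpow hd.le]
    rw [e1, e2]
    set s := r⁻¹ with hs
    set d := (y - x)⁻¹ with hdd
    have hs0 : 0 < s := by positivity
    have hd0 : 0 < d := by positivity
    have c1' : (M'.card : ℝ) ≤ C * s * d := by
      convert c1 using 1
      rw [hs, hdd]
      field_simp
    have c2' : (M'.card : ℝ) ≤ C * s * s := by
      convert c2 using 1
      rw [hs]
      field_simp
    have hmin : min s d ≤ s ^ ε * d ^ (1 - ε) := by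
      have hm : 0 < min s d := lt_min hs0 hd0
      calc min s d = (min s d) ^ ε * (min s d) ^ (1 - ε) := by
            rw [← Real.rpow_add hm]
            simp
        _ ≤ s ^ ε * d ^ (1 - ε) := by
            refine mul_le_mul (Real.rpow_le_rpow hm.le (min_le_left _ _) hε.le)
              (Real.rpow_le_rpow hm.le (min_le_right _ _) (by linarith)) (by positivity)
              (by positivity)
    calc (M'.card : ℝ) ≤ C * s * min s d := by
          rcases min_choice s d with h | h <;> rw [h] <;> assumption
      _ ≤ C * s * (s ^ ε * d ^ (1 - ε)) := by gcongr
      _ = _ := by ring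
  have hφneg : ∀ u, φ (-u) = φ u := by
    intro u
    simp only [φ, Set.indicator, mem_ball_zero_iff, norm_neg, abs_neg]
  have pt : ∀ x y : ℝ, x ≠ y →
      ∑ i ∈ M, (A i).indicator (1 : ℝ → ℝ≥0∞) x * (A i).indicator (1 : ℝ → ℝ≥0∞) y ≤
        (Set.Ioo a b).indicator (1 : ℝ → ℝ≥0∞) x *
          (ENNReal.ofReal (C * r ^ (-1 - ε)) * φ (y - x)) := by
    intro x y hxy
    let M' := M.filter fun i => x ∈ A i ∧ y ∈ A i
    have hsum : ∑ i ∈ M, (A i).indicator (1 : ℝ → ℝ≥0∞) x * (A i).indicator (1 : ℝ → ℝ≥0∞) y =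
        (M'.card : ℝ≥0∞) := by
      rw [Finset.card_filter]
      push_cast
      refine Finset.sum_congr rfl fun i _ => ?_
      by_cases h1 : x ∈ A i <;> by_cases h2 : y ∈ A i <;> simp [h1, h2]
    rw [hsum]
    rcases M'.eq_empty_or_nonempty with h0 | ⟨i, hi⟩
    · simp [h0]
    · have hi' := (Finset.mem_filter.1 hi)
      have hx := hAI i hi'.1 hi'.2.1
      have hy := hAI i hi'.1 hi'.2.2
      rw [Set.indicator_of_mem hx, Pi.one_apply, one_mul]
      rcases lt_or_gt_of_ne hxy with h | h
      · exact bound x y h hx hy M' (Finset.filter_subset _ _)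
          (fun i hi => (Finset.mem_filter.1 hi).2.1) (fun i hi => (Finset.mem_filter.1 hi).2.2)
      · rw [← neg_sub x y, hφneg]
        exact bound y x h hy hx M' (Finset.filter_subset _ _)
          (fun i hi => (Finset.mem_filter.1 hi).2.2) (fun i hi => (Finset.mem_filter.1 hi).2.1)
  have hind : ∀ i ∈ M, Measurable ((A i).indicator (1 : ℝ → ℝ≥0∞)) :=
    fun i hi => measurable_one.indicator (hA i hi)
  have sq : ∀ i ∈ M, volume (A i) ^ 2 =
      ∫⁻ x, ∫⁻ y, (A i).indicator (1 : ℝ → ℝ≥0∞) x * (A i).indicator (1 : ℝ → ℝ≥0∞) y := by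
    intro i hi
    simp_rw [lintegral_const_mul _ (hind i hi)]
    rw [lintegral_mul_const _ (hind i hi), lintegral_indicator_one (hA i hi), pow_two]
  rw [Finset.sum_congr rfl sq, ← lintegral_finsetSum]
  swap
  · intro i hi
    simp_rw [lintegral_const_mul _ (hind i hi)]
    exact (hind i hi).mul_const _
  calc ∫⁻ x, ∑ i ∈ M,
        ∫⁻ y, (A i).indicator (1 : ℝ → ℝ≥0∞) x * (A i).indicator (1 : ℝ → ℝ≥0∞) y
      ≤ ∫⁻ x, (Set.Ioo a b).indicator (1 : ℝ → ℝ≥0∞) x *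
          (ENNReal.ofReal (C * r ^ (-1 - ε)) * ∫⁻ u, φ u) := by
        refine lintegral_mono fun x => ?_
        rw [← lintegral_finsetSum _ fun i hi => (hind i hi).const_mul _]
        calc _ ≤ ∫⁻ y, (Set.Ioo a b).indicator (1 : ℝ → ℝ≥0∞) x *
              (ENNReal.ofReal (C * r ^ (-1 - ε)) * φ (y - x)) := by
              refine lintegral_mono_ae ?_
              -- The pair bound says nothing on the diagonal, which is null.
              filter_upwards [Measure.ae_ne volume x] with y hy
              exact pt x y hy.symm
          _ = _ := by
              rw [lintegral_const_mul _ (by fun_prop), lintegral_const_mul _ (by fun_prop),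
                lintegral_sub_right_eq_self φ x]
    _ = volume (Set.Ioo a b) * (ENNReal.ofReal (C * r ^ (-1 - ε)) * ∫⁻ u, φ u) := by
        rw [lintegral_mul_const _ (measurable_one.indicator measurableSet_Ioo),
          lintegral_indicator_one measurableSet_Ioo]
    _ ≤ 1 * (ENNReal.ofReal (C * r ^ (-1 - ε)) * ∫⁻ u, φ u) := by
        gcongr
        rw [Real.volume_Ioo, ← ENNReal.ofReal_one]
        exact ENNReal.ofReal_le_ofReal hab
    _ = _ := by rw [one_mul, mul_comm]

/-- Lebesgue measure in the plane as the integral of the lengths of horizontal slices. -/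
theorem volume_eq_lintegral_slices {S : Set (EuclideanSpace ℝ (Fin 2))} (hS : MeasurableSet S) :
    volume S = ∫⁻ h : ℝ, volume {x : ℝ | (!₂[x, h] : EuclideanSpace ℝ (Fin 2)) ∈ S} := by
  have h1 := (EuclideanSpace.volume_preserving_symm_measurableEquiv_toLp (Fin 2)).symm
  have h2 := (volume_preserving_finTwoArrow ℝ).symm
  have h3 := (h1.comp h2).comp (Measure.measurePreserving_swap (μ := volume) (ν := volume))
  rw [← h3.measure_preimage hS.nullMeasurableSet, Measure.prod_apply (h3.measurable hS)]
  rfl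

theorem measurable_volume_slice {S : Set (EuclideanSpace ℝ (Fin 2))} (hS : MeasurableSet S) :
    Measurable fun h : ℝ => volume {x : ℝ | (!₂[x, h] : EuclideanSpace ℝ (Fin 2)) ∈ S} := by
  have hm : Measurable fun z : ℝ × ℝ => (!₂[z.2, z.1] : EuclideanSpace ℝ (Fin 2)) := by
    refine Continuous.measurable ?_
    fun_prop
  exact measurable_measure_prodMk_left (hm hS)

/-- A linearised substitute for Cauchy–Schwarz: the free parameter `l` is later a power of the
scale, and no square root of an integral appears. -/
theorem ENNReal.le_add_inv_mul_sq {a l : ℝ≥0∞} (hl : l ≠ 0) (hl' : l ≠ ⊤) :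
    a ≤ l + l⁻¹ * a ^ 2 := by
  rcases le_total a l with h | h
  · exact h.trans le_self_add
  · refine le_trans ?_ le_add_self
    calc a = l⁻¹ * l * a := by rw [ENNReal.inv_mul_cancel hl hl', one_mul]
      _ ≤ l⁻¹ * a * a := by gcongr
      _ = _ := by ring

theorem volume_le_add_lintegral_sq_slices {S : Set (EuclideanSpace ℝ (Fin 2))}
    (hS : MeasurableSet S) {h₀ h₁ : ℝ} (hh : h₁ - h₀ ≤ 1) (hSh : ∀ x ∈ S, x 1 ∈ Set.Ioo h₀ h₁)
    {l : ℝ≥0∞} (hl : l ≠ 0) (hl' : l ≠ ⊤) :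
    volume S ≤ l + l⁻¹ * ∫⁻ h in Set.Ioo h₀ h₁,
      volume {x : ℝ | (!₂[x, h] : EuclideanSpace ℝ (Fin 2)) ∈ S} ^ 2 := by
  have hm := measurable_volume_slice hS
  rw [volume_eq_lintegral_slices hS]
  have hsupp : ∫⁻ h : ℝ, volume {x : ℝ | (!₂[x, h] : EuclideanSpace ℝ (Fin 2)) ∈ S} =
      ∫⁻ h in Set.Ioo h₀ h₁, volume {x : ℝ | (!₂[x, h] : EuclideanSpace ℝ (Fin 2)) ∈ S} := by
    rw [← lintegral_indicator measurableSet_Ioo]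
    congr 1
    ext h
    by_cases hh : h ∈ Set.Ioo h₀ h₁
    · rw [Set.indicator_of_mem hh]
    · rw [Set.indicator_of_notMem hh]
      have : {x : ℝ | (!₂[x, h] : EuclideanSpace ℝ (Fin 2)) ∈ S} = ∅ := by
        ext x
        simp only [Set.mem_ofPred_eq, Set.mem_empty_iff_false, iff_false]
        intro hx
        exact hh (by simpa using hSh _ hx)
      rw [this, measure_empty]
  rw [hsupp]
  calc _ ≤ ∫⁻ h in Set.Ioo h₀ h₁,
        (l + l⁻¹ * volume {x : ℝ | (!₂[x, h] : EuclideanSpace ℝ (Fin 2)) ∈ S} ^ 2) :=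
        lintegral_mono fun h => ENNReal.le_add_inv_mul_sq hl hl'
    _ = l * volume (Set.Ioo h₀ h₁) + l⁻¹ * ∫⁻ h in Set.Ioo h₀ h₁,
          volume {x : ℝ | (!₂[x, h] : EuclideanSpace ℝ (Fin 2)) ∈ S} ^ 2 := by
        rw [lintegral_add_left measurable_const, setLIntegral_const,
          lintegral_const_mul _ (hm.pow_const 2)]
    _ ≤ _ := by
        gcongr
        refine (mul_le_mul_right (?_ : volume (Set.Ioo h₀ h₁) ≤ 1) l).trans_eq (mul_one l)
        rw [Real.volume_Ioo, ← ENNReal.ofReal_one]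
        exact ENNReal.ofReal_le_ofReal hh

/-! ### Dyadic covers -/

theorem exists_subset_gridSquare {A : Set (EuclideanSpace ℝ (Fin 2))} {r : ℝ} (hr : 0 < r)
    (hA : Metric.ediam A ≤ ENNReal.ofReal (r / 4)) : ∃ m, A ⊆ gridSquare r m := by
  rcases A.eq_empty_or_nonempty with rfl | ⟨p, hp⟩
  · exact ⟨0, Set.empty_subset _⟩
  refine ⟨(round (p 0 / r), round (p 1 / r)), fun q hq => ?_⟩
  have hd : dist q p ≤ r / 4 := by
    have := (Metric.edist_le_ediam_of_mem hq hp).trans hA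
    rwa [edist_dist, ENNReal.ofReal_le_ofReal_iff (by positivity)] at this
  have hcoord : ∀ i, |q i - r * round (p i / r)| < r := by
    intro i
    have h1 : |q i - p i| ≤ r / 4 := by
      have := PiLp.norm_apply_le (q - p) i
      rw [← dist_eq_norm] at this
      exact le_trans (by simpa using this) hd
    have h2 : |p i - r * round (p i / r)| ≤ r / 2 := by
      have h3 := abs_sub_round (p i / r)
      have h4 : p i - r * round (p i / r) = r * (p i / r - round (p i / r)) := by
        field_simp
      rw [h4, abs_mul, abs_of_pos hr]
      linarith [mul_le_mul_of_nonneg_left h3 hr.le]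
    calc _ = |(q i - p i) + (p i - r * round (p i / r))| := by ring_nf
      _ ≤ r / 4 + r / 2 := (abs_add_le _ _).trans (add_le_add h1 h2)
      _ < r := by linarith
  exact ⟨hcoord 0, hcoord 1⟩

/-- A null set has covers by grid squares of arbitrarily small dyadic size with uniformly bounded
`σ`-dimensional content. -/
theorem exists_gridSquare_cover {Γ : Set (EuclideanSpace ℝ (Fin 2))} {σ : ℝ} (hσ : 1 ≤ σ)
    (hΓ : μH[σ] Γ = 0) (j : ℕ) :
    ∃ T : Set (ℕ × ℤ × ℤ), (∀ u ∈ Γ, ∃ z ∈ T, u ∈ gridSquare ((1 / 2) ^ (j + z.1)) z.2) ∧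
      ∑' z, T.indicator (fun z => ENNReal.ofReal ((1 / 2) ^ (j + z.1)) ^ σ) z ≤
        ENNReal.ofReal 8 ^ σ * 3 := by
  classical
  have hσ0 : 0 ≤ σ := by linarith
  -- A set of diameter at most a quarter of the scale fits in one grid square, so this threshold
  -- keeps all scales at most `(1 / 2) ^ j`.
  set s : ℝ := (1 / 2) ^ j / 4 with hs
  have hs0 : 0 < s := by positivity
  have hs1 : s ≤ 1 := by
    have : ((1 : ℝ) / 2) ^ j ≤ 1 := pow_le_one₀ (by norm_num) (by norm_num)
    rw [hs]; linarith
  rw [Measure.hausdorffMeasure_apply] at hΓ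
  have hlt : (⨅ t : ℕ → Set (EuclideanSpace ℝ (Fin 2)), ⨅ (_ : Γ ⊆ ⋃ n, t n),
      ⨅ (_ : ∀ n, Metric.ediam (t n) ≤ ENNReal.ofReal s),
        ∑' n, ⨆ _ : (t n).Nonempty, Metric.ediam (t n) ^ σ) < 1 := by
    refine lt_of_le_of_lt ?_ one_pos
    rw [← hΓ]
    exact le_iSup₂_of_le (ENNReal.ofReal s) (ENNReal.ofReal_pos.2 hs0) le_rfl
  simp only [iInf_lt_iff] at hlt
  obtain ⟨t, hcov, hdiam, hsum⟩ := hlt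
  -- The padding gives sets of zero diameter a positive size. As `σ ≥ 1`, it adds at most a
  -- geometric series with sum `2`, whence the constant `3 = 1 + 2`; the `8` comes from rounding `4
  -- * d n` up to a dyadic scale.
  let d : ℕ → ℝ := fun n => max (Metric.ediam (t n)).toReal (s * (1 / 2) ^ n)
  have hfin : ∀ n, Metric.ediam (t n) ≠ ⊤ := fun n => ne_top_of_le_ne_top ofReal_ne_top (hdiam n)
  have hd0 : ∀ n, 0 < d n := fun n => lt_max_of_lt_right (by positivity)
  have hds : ∀ n, d n ≤ s := by
    intro n
    refine max_le (ENNReal.toReal_le_of_le_ofReal hs0.le (hdiam n)) ?_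
    exact mul_le_of_le_one_right hs0.le (pow_le_one₀ (by norm_num) (by norm_num))
  have hi : ∀ n, ∃ i : ℕ, (1 / 2 : ℝ) ^ (i + 1) < d n / s ∧ d n / s ≤ (1 / 2) ^ i := by
    intro n
    exact exists_nat_pow_near_of_lt_one (div_pos (hd0 n) hs0) ((div_le_one hs0).2 (hds n))
      (by norm_num) (by norm_num)
  choose i hi1 hi2 using hi
  have hr0 : ∀ n, (0 : ℝ) < (1 / 2) ^ (j + i n) := fun n => by positivity
  have hrs : ∀ n, ((1 : ℝ) / 2) ^ (j + i n) = 4 * s * (1 / 2) ^ i n := by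
    intro n
    rw [pow_add, hs]
    ring
  have hup : ∀ n, ((1 : ℝ) / 2) ^ (j + i n) ≤ 8 * d n := by
    intro n
    have := hi1 n
    rw [lt_div_iff₀ hs0, pow_succ] at this
    rw [hrs]
    linarith
  have hlow : ∀ n, d n ≤ (1 / 2) ^ (j + i n) / 4 := by
    intro n
    have := hi2 n
    rw [div_le_iff₀ hs0] at this
    rw [hrs]
    linarith
  have hm : ∀ n, ∃ m, t n ⊆ gridSquare ((1 / 2) ^ (j + i n)) m := by
    intro n
    refine exists_subset_gridSquare (hr0 n) ?_
    rw [← ENNReal.ofReal_toReal (hfin n)]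
    exact ENNReal.ofReal_le_ofReal ((le_max_left _ _).trans (hlow n))
  choose m hm using hm
  refine ⟨{z | ∃ n, (t n).Nonempty ∧ (i n, m n) = z}, ?_, ?_⟩
  · intro u hu
    obtain ⟨n, hn⟩ := Set.mem_iUnion.1 (hcov hu)
    exact ⟨(i n, m n), ⟨n, ⟨u, hn⟩, rfl⟩, hm n hn⟩
  set f : ℕ × ℤ × ℤ → ℝ≥0∞ := fun z => ENNReal.ofReal ((1 / 2) ^ (j + z.1)) ^ σ with hf
  have step1 : ∀ z, Set.indicator {z | ∃ n, (t n).Nonempty ∧ (i n, m n) = z} f z ≤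
      ∑' n, if (i n, m n) = z then (if (t n).Nonempty then f z else 0) else 0 := by
    intro z
    by_cases hz : z ∈ {z | ∃ n, (t n).Nonempty ∧ (i n, m n) = z}
    · rw [Set.indicator_of_mem hz]
      obtain ⟨n, hn, rfl⟩ := hz
      refine le_trans ?_ (ENNReal.le_tsum n)
      simp [hn]
    · rw [Set.indicator_of_notMem hz]
      exact zero_le
  have step2 : ∀ n, (if (t n).Nonempty then f (i n, m n) else 0) ≤
      ENNReal.ofReal 8 ^ σ *
        ((⨆ _ : (t n).Nonempty, Metric.ediam (t n) ^ σ) + ENNReal.ofReal ((1 / 2) ^ n)) := by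
    intro n
    split_ifs with hn
    · have h1 : f (i n, m n) ≤ ENNReal.ofReal 8 ^ σ * ENNReal.ofReal (d n) ^ σ := by
        rw [hf, ← ENNReal.mul_rpow_of_nonneg _ _ hσ0, ← ENNReal.ofReal_mul (by norm_num)]
        exact ENNReal.rpow_le_rpow (ENNReal.ofReal_le_ofReal (hup n)) hσ0
      refine h1.trans ?_
      gcongr
      rw [iSup_pos hn]
      rcases max_choice (Metric.ediam (t n)).toReal (s * (1 / 2) ^ n) with h | h
      · simp only [d, h]
        rw [ENNReal.ofReal_toReal (hfin n)]
        exact le_self_add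
      · simp only [d, h]
        refine le_trans ?_ le_add_self
        have hle : s * (1 / 2) ^ n ≤ (1 / 2) ^ n := mul_le_of_le_one_left (by positivity) hs1
        have hle1 : ENNReal.ofReal ((1 / 2) ^ n) ≤ 1 := by
          rw [← ENNReal.ofReal_one]
          exact ENNReal.ofReal_le_ofReal (pow_le_one₀ (by norm_num) (by norm_num))
        calc _ ≤ ENNReal.ofReal ((1 / 2) ^ n) ^ σ :=
              ENNReal.rpow_le_rpow (ENNReal.ofReal_le_ofReal hle) hσ0
          _ ≤ ENNReal.ofReal ((1 / 2) ^ n) ^ (1 : ℝ) := ENNReal.rpow_le_rpow_of_exponent_ge hle1 hσ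
          _ = _ := ENNReal.rpow_one _
    · exact zero_le
  have hgeo : ∑' n : ℕ, ENNReal.ofReal ((1 / 2) ^ n) = 2 := by
    rw [← ENNReal.ofReal_tsum_of_nonneg (fun n => by positivity) summable_geometric_two,
      tsum_geometric_two]
    simp
  calc _ ≤ ∑' z, ∑' n, if (i n, m n) = z then (if (t n).Nonempty then f z else 0) else 0 :=
        ENNReal.tsum_le_tsum step1
    _ = ∑' n, if (t n).Nonempty then f (i n, m n) else 0 := by
        rw [ENNReal.tsum_comm]
        congr 1
        ext n
        rw [tsum_eq_single (i n, m n)]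
        · rw [if_pos rfl]
        · intro z hz
          rw [if_neg (Ne.symm hz)]
    _ ≤ ∑' n, ENNReal.ofReal 8 ^ σ *
        ((⨆ _ : (t n).Nonempty, Metric.ediam (t n) ^ σ) + ENNReal.ofReal ((1 / 2) ^ n)) :=
        ENNReal.tsum_le_tsum step2
    _ = ENNReal.ofReal 8 ^ σ * ((∑' n, ⨆ _ : (t n).Nonempty, Metric.ediam (t n) ^ σ) + 2) := by
        rw [ENNReal.tsum_mul_left, ENNReal.tsum_add, hgeo]
    _ ≤ ENNReal.ofReal 8 ^ σ * (1 + 2) := by gcongr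
    _ = _ := by norm_num

/-! ### Visible parts from one box of viewpoints -/

/-- The open rectangle `(a, b) × (h₀, h₁)`. -/
def openBox (a b h₀ h₁ : ℝ) : Set (EuclideanSpace ℝ (Fin 2)) :=
  {x | x 0 ∈ Set.Ioo a b ∧ x 1 ∈ Set.Ioo h₀ h₁}

theorem isOpen_openBox (a b h₀ h₁ : ℝ) : IsOpen (openBox a b h₀ h₁) := by
  have : openBox a b h₀ h₁ = (fun x : EuclideanSpace ℝ (Fin 2) => x 0) ⁻¹' Set.Ioo a b ∩
      (fun x : EuclideanSpace ℝ (Fin 2) => x 1) ⁻¹' Set.Ioo h₀ h₁ := rfl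
  rw [this]
  exact (isOpen_Ioo.preimage (by fun_prop)).inter (isOpen_Ioo.preimage (by fun_prop))

theorem exists_sum_sq_slices_sightSet_le {Γ : Set (EuclideanSpace ℝ (Fin 2))}
    (hcomp : IsCompact Γ) (hconn : IsPreconnected Γ) {a b h₀ h₁ c ε : ℝ} (hab : b - a ≤ 1)
    (hdisj : Disjoint Γ (openBox a b h₀ h₁)) (hc : 0 < c) (hε : 0 < ε) (hε1 : ε ≤ 1) :
    ∃ (M : ℕ → Finset (ℤ × ℤ)) (k₀ : ℕ) (K : ℝ≥0∞), K ≠ ⊤ ∧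
      (∀ k m u, u ∈ Γ → h₁ + c ≤ u 1 → u ∈ gridSquare ((1 / 2) ^ k) m → m ∈ M k) ∧
      ∀ k ≥ k₀, ∀ h ∈ Set.Ioo h₀ h₁, ∑ m ∈ M k, volume {x : ℝ | (!₂[x, h] :
        EuclideanSpace ℝ (Fin 2)) ∈ openBox a b h₀ h₁ ∩
          sightSet Γ (gridSquare ((1 / 2) ^ k) m)} ^ 2 ≤
        K * ENNReal.ofReal ((1 / 2) ^ k) ^ (-1 - ε) := by
  classical
  obtain ⟨R₀, hR₀pos, hR₀⟩ := hcomp.isBounded.exists_pos_norm_le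
  have hcoord : ∀ u ∈ Γ, ∀ i, |u i| ≤ R₀ := fun u hu i =>
    (PiLp.norm_apply_le u i).trans (hR₀ u hu)
  set R : ℝ := R₀ + 2 + |a| + |b| + |h₀| + |h₁| with hR
  have hRpos : 0 < R := by positivity
  obtain ⟨C₁, hC₁, hcount⟩ := exists_card_common_sight_le (half_pos hc) hRpos
  obtain ⟨K, hK, hsq⟩ := exists_sum_sq_volume_le hε hε1
  -- A square has side `2 * r < c / 2`, so a square meeting `Γ` at height at least `h₁ + c` stays at
  -- least `c / 2` above every viewpoint.
  obtain ⟨k₀, hk₀⟩ := exists_pow_lt_of_lt_one (show 0 < c / 4 by positivity)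
    (show (1 / 2 : ℝ) < 1 by norm_num)
  set C : ℝ := max C₁ ((2 * R₀ + 5) ^ 2) with hC
  have hCpos : 0 < C := lt_max_of_lt_left hC₁
  let n : ℕ → ℕ := fun k => ⌈(R₀ + 1) / (1 / 2) ^ k⌉₊
  let M : ℕ → Finset (ℤ × ℤ) := fun k =>
    (Finset.Icc (-n k : ℤ) (n k) ×ˢ Finset.Icc (-n k : ℤ) (n k)).filter
      fun m => ∃ u ∈ Γ, u ∈ gridSquare ((1 / 2) ^ k) m ∧ h₁ + c ≤ u 1
  refine ⟨M, k₀, K * ENNReal.ofReal C, ENNReal.mul_ne_top hK ofReal_ne_top, ?_, ?_⟩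
  · intro k m u hu hu1 hum
    have hr : (0 : ℝ) < (1 / 2) ^ k := by positivity
    have hr1 : ((1 : ℝ) / 2) ^ k ≤ 1 := pow_le_one₀ (by norm_num) (by norm_num)
    refine Finset.mem_filter.2 ⟨?_, u, hu, hum, hu1⟩
    have key : ∀ (i : Fin 2) (z : ℤ), |u i - (1 / 2) ^ k * z| < (1 / 2) ^ k →
        z ∈ Finset.Icc (-n k : ℤ) (n k) := by
      intro i z hz
      have h1 : |(1 / 2) ^ k * (z : ℝ)| ≤ R₀ + 1 := by
        have := abs_sub_abs_le_abs_sub ((1 / 2) ^ k * (z : ℝ)) (u i)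
        rw [abs_sub_comm] at this
        linarith [hcoord u hu i]
      have h2 : |(z : ℝ)| ≤ n k := by
        refine le_trans ?_ (Nat.le_ceil _)
        rw [abs_mul, abs_of_pos hr] at h1
        rw [le_div_iff₀ hr]
        linarith
      rw [Finset.mem_Icc, ← abs_le]
      exact_mod_cast h2
    exact Finset.mem_product.2 ⟨key 0 _ hum.1, key 1 _ hum.2⟩
  · intro k hk h hh
    set r : ℝ := (1 / 2) ^ k with hrdef
    have hr : 0 < r := by positivity
    have hr1 : r ≤ 1 := pow_le_one₀ (by norm_num) (by norm_num)
    have hrc : r < c / 4 := lt_of_le_of_lt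
      (pow_le_pow_of_le_one (by norm_num) (by norm_num) hk) hk₀
    have hpow : ENNReal.ofReal r ^ (-1 - ε) = ENNReal.ofReal (r ^ (-1 - ε)) :=
      ENNReal.ofReal_rpow_of_pos hr
    rw [hpow, mul_assoc, ← ENNReal.ofReal_mul hCpos.le]
    have hslice : Continuous fun x : ℝ => (!₂[x, h] : EuclideanSpace ℝ (Fin 2)) := by fun_prop
    refine hsq (M k) _ a b C r ?_ ?_ hab hr hCpos ?_ ?_
    · intro m _
      exact (((isOpen_openBox a b h₀ h₁).inter (isOpen_sightSet hcomp.isClosed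
        (isOpen_gridSquare r m))).preimage hslice).measurableSet
    · intro m _ x hx
      simpa using hx.1.1
    · intro x hx y hy hxy M' hM' hxA hyA
      have hle : C₁ / (r * (y - x)) ≤ C / (r * (y - x)) := by
        have : 0 < y - x := by linarith
        gcongr
        exact le_max_left _ _
      have hxR : ∀ z ∈ Set.Ioo a b, |z| ≤ R := by
        intro z hz
        have h1 : |z| ≤ max |a| |b| := abs_le_max_abs_abs hz.1.le hz.2.le
        have h2 : max |a| |b| ≤ |a| + |b| := max_le_add_of_nonneg (abs_nonneg _) (abs_nonneg _)
        linarith [abs_nonneg h₀, abs_nonneg h₁]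
      refine (hcount Γ hconn x y h r hr hr1 hxy (by linarith [hx.1, hy.2]) (hxR x hx) (hxR y hy)
        ?_ M' ?_ ?_ (fun m hm => (hxA m hm).2) (fun m hm => (hyA m hm).2)).trans hle
      · intro p hp hp1 hxp hpy
        exact Set.disjoint_left.1 hdisj hp
          ⟨⟨hx.1.trans_le hxp, hpy.trans_lt hy.2⟩, by rw [hp1]; exact hh⟩
      · intro m hm
        obtain ⟨u, hu, hum, -⟩ := (Finset.mem_filter.1 (hM' hm)).2
        exact ⟨u, hu, hum⟩
      · intro m hm p hp
        obtain ⟨u, hu, hum, hu1⟩ := (Finset.mem_filter.1 (hM' hm)).2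
        have p0 := abs_lt.1 hp.1
        have p1 := abs_lt.1 hp.2
        have u0 := abs_lt.1 hum.1
        have u1 := abs_lt.1 hum.2
        have c0 := abs_le.1 (hcoord u hu 0)
        have c1 := abs_le.1 (hcoord u hu 1)
        have hh2 := hh.2
        have hh1 := hh.1
        refine ⟨by linarith, ?_, abs_le.2 ⟨?_, ?_⟩⟩ <;>
          linarith [abs_nonneg a, abs_nonneg b, abs_nonneg h₀, abs_nonneg h₁, neg_abs_le h₀]
    · have h1 : (n k : ℝ) ≤ (R₀ + 1) / r + 1 := (Nat.ceil_lt_add_one (by positivity)).le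
      have h2 : (2 * n k + 1 : ℝ) ≤ (2 * R₀ + 5) / r := by
        have h3 : (1 : ℝ) ≤ 1 / r := by rw [le_div_iff₀ hr]; linarith
        have h4 : (2 * R₀ + 5) / r = 2 * ((R₀ + 1) / r) + 3 * (1 / r) := by
          field_simp
          ring
        linarith
      have h3 : (M k).card ≤ (2 * n k + 1) * (2 * n k + 1) := by
        refine (Finset.card_filter_le _ _).trans (le_of_eq ?_)
        rw [Finset.card_product, Int.card_Icc]
        have : ((n k : ℤ) + 1 - -(n k : ℤ)).toNat = 2 * n k + 1 := by omega
        rw [this]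
      calc ((M k).card : ℝ) ≤ (2 * n k + 1) * (2 * n k + 1) := by exact_mod_cast h3
        _ ≤ ((2 * R₀ + 5) / r) * ((2 * R₀ + 5) / r) := by gcongr
        _ = (2 * R₀ + 5) ^ 2 / r ^ 2 := by rw [← pow_two, div_pow]
        _ ≤ C / r ^ 2 := by gcongr; exact le_max_right _ _

/-- `F j x` dominates the `t`-content of those covering squares that `x` sees, and its integral
decays like `q ^ j`. The `3 * κ` in `t` pays for the `κ` lost in the second moment and for
convergence of both error terms. -/
theorem ae_openBox_hausdorffMeasure_visiblePart_eq_zero {Γ : Set (EuclideanSpace ℝ (Fin 2))}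
    (hcomp : IsCompact Γ) (hconn : IsPreconnected Γ) {a b h₀ h₁ c σ κ t : ℝ} (hab : b - a ≤ 1)
    (hh : h₁ - h₀ ≤ 1) (hdisj : Disjoint Γ (openBox a b h₀ h₁)) (hc : 0 < c) (hσ : 1 ≤ σ)
    (hκ : 0 < κ) (hκ1 : κ ≤ 1) (ht : 2 * t = σ + 1 + 3 * κ) (hΓ : μH[σ] Γ = 0) :
    ∀ᵐ x : EuclideanSpace ℝ (Fin 2), x ∈ openBox a b h₀ h₁ →
      μH[t] (visiblePart Γ x ∩ {u | h₁ + c ≤ u 1}) = 0 := by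
  classical
  have ht0 : 0 < t := by linarith
  obtain ⟨M, k₀, K, hK, hM, hsum⟩ :=
    exists_sum_sq_slices_sightSet_le hcomp hconn hab hdisj hc hκ hκ1
  choose T hTcov hTsum using exists_gridSquare_cover hσ hΓ
  let ρ : ℕ → ℝ≥0∞ := fun k => ENNReal.ofReal ((1 / 2) ^ k)
  have hρ0 : ∀ k, ρ k ≠ 0 := fun k => by
    simp only [ρ, ne_eq, ENNReal.ofReal_eq_zero, not_le]
    positivity
  have hρt : ∀ k, ρ k ≠ ⊤ := fun k => ofReal_ne_top
  have hρadd : ∀ j i, ρ (j + i) = ρ j * ρ i := fun j i => by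
    simp only [ρ]
    rw [pow_add, ENNReal.ofReal_mul (by positivity)]
  have hρ1 : ∀ k, ρ k ≤ 1 := fun k => by
    simp only [ρ]
    rw [← ENNReal.ofReal_one]
    exact ENNReal.ofReal_le_ofReal (pow_le_one₀ (by norm_num) (by norm_num))
  set q : ℝ≥0∞ := ENNReal.ofReal (1 / 2) ^ κ with hq
  have hq1 : q < 1 := ENNReal.rpow_lt_one (by
    rw [← ENNReal.ofReal_one, ENNReal.ofReal_lt_ofReal_iff one_pos]; norm_num) hκ
  have hρq : ∀ k, ρ k ^ κ = q ^ k := fun k => by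
    simp only [ρ]
    rw [hq, ENNReal.ofReal_pow (by norm_num), ← ENNReal.rpow_natCast, ← ENNReal.rpow_mul,
      ← ENNReal.rpow_natCast, ← ENNReal.rpow_mul, mul_comm]
  let S : ℕ → ℤ × ℤ → Set (EuclideanSpace ℝ (Fin 2)) := fun k m =>
    openBox a b h₀ h₁ ∩ sightSet Γ (gridSquare ((1 / 2) ^ k) m)
  have hSm : ∀ k m, MeasurableSet (S k m) := fun k m =>
    ((isOpen_openBox a b h₀ h₁).inter
      (isOpen_sightSet hcomp.isClosed (isOpen_gridSquare _ m))).measurableSet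
  let Z : ℕ → ℤ × ℤ → ℝ≥0∞ := fun k m => ∫⁻ h in Set.Ioo h₀ h₁,
    volume {x : ℝ | (!₂[x, h] : EuclideanSpace ℝ (Fin 2)) ∈ S k m} ^ 2
  have hZ : ∀ k ≥ k₀, ∑ m ∈ M k, Z k m ≤ K * ρ k ^ (-1 - κ) := by
    intro k hk
    rw [← lintegral_finsetSum _ fun m _ => (measurable_volume_slice (hSm k m)).pow_const 2]
    calc _ ≤ ∫⁻ _ in Set.Ioo h₀ h₁, K * ρ k ^ (-1 - κ) :=
          setLIntegral_mono measurable_const fun h hh => hsum k hk h hh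
      _ = K * ρ k ^ (-1 - κ) * volume (Set.Ioo h₀ h₁) := setLIntegral_const _ _
      _ ≤ K * ρ k ^ (-1 - κ) * 1 := by
          gcongr
          rw [Real.volume_Ioo, ← ENNReal.ofReal_one]
          exact ENNReal.ofReal_le_ofReal hh
      _ = _ := mul_one _
  -- The parameter `l = ρ k ^ ((σ - 1 - κ) / 2)` makes the first term summable against the
  -- `σ`-content of the cover, and lets `ρ k ^ (1 + 2 * κ)` beat the second-moment bound `ρ k ^ (-1
  -- - κ)`.
  have hvol : ∀ k m, ρ k ^ t * volume (S k m) ≤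
      ρ k ^ (σ + κ) + ρ k ^ (1 + 2 * κ) * Z k m := by
    intro k m
    have := volume_le_add_lintegral_sq_slices (hSm k m) hh (fun x hx => hx.1.2)
      (l := ρ k ^ ((σ - 1 - κ) / 2)) (ENNReal.rpow_pos (pos_iff_ne_zero.2 (hρ0 k)) (hρt k)).ne'
      (ENNReal.rpow_ne_top_of_ne_zero (hρ0 k) (hρt k))
    refine (mul_le_mul_right this _).trans (le_of_eq ?_)
    rw [mul_add, ← mul_assoc, ← ENNReal.rpow_neg, ← ENNReal.rpow_add _ _ (hρ0 k) (hρt k),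
      ← ENNReal.rpow_add _ _ (hρ0 k) (hρt k)]
    rw [show t + (σ - 1 - κ) / 2 = σ + κ by linarith,
      show t + -((σ - 1 - κ) / 2) = 1 + 2 * κ by linarith]
  let W : ℕ → ℕ × ℤ × ℤ → ℝ≥0∞ := fun j =>
    {z | z ∈ T j ∧ z.2 ∈ M (j + z.1)}.indicator fun z => ENNReal.ofReal 4 ^ t * ρ (j + z.1) ^ t
  let F : ℕ → EuclideanSpace ℝ (Fin 2) → ℝ≥0∞ := fun j x =>
    ∑' z, W j z * (S (j + z.1) z.2).indicator 1 x
  have hind : ∀ k m, Measurable ((S k m).indicator (1 : EuclideanSpace ℝ (Fin 2) → ℝ≥0∞)) :=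
    fun k m => measurable_one.indicator (hSm k m)
  have hFm : ∀ j, Measurable (F j) := fun j =>
    Measurable.tsum fun z => (hind _ _).const_mul _
  set D : ℝ≥0∞ := ENNReal.ofReal 4 ^ t * (ENNReal.ofReal 8 ^ σ * 3 + K * (1 - q)⁻¹) with hD
  have hDtop : D ≠ ⊤ := by
    refine ENNReal.mul_ne_top (ENNReal.rpow_ne_top_of_nonneg ht0.le ofReal_ne_top)
      (ENNReal.add_ne_top.2 ⟨ENNReal.mul_ne_top (ENNReal.rpow_ne_top_of_nonneg (by linarith)
        ofReal_ne_top) (by norm_num), ENNReal.mul_ne_top hK ?_⟩)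
    exact ENNReal.inv_ne_top.2 (tsub_pos_of_lt hq1).ne'
  have hFint : ∀ j ≥ k₀, ∫⁻ x, F j x ≤ D * q ^ j := by
    intro j hj
    have e : ∫⁻ x, F j x = ∑' z, W j z * volume (S (j + z.1) z.2) := by
      rw [lintegral_tsum fun z => ((hind _ _).const_mul _).aemeasurable]
      congr 1
      ext z
      rw [lintegral_const_mul _ (hind _ _), lintegral_indicator_one (hSm _ _)]
    have pt : ∀ z : ℕ × ℤ × ℤ, W j z * volume (S (j + z.1) z.2) ≤ ENNReal.ofReal 4 ^ t *
        (q ^ j * (T j).indicator (fun z => ENNReal.ofReal ((1 / 2) ^ (j + z.1)) ^ σ) z +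
          if z.2 ∈ M (j + z.1) then ρ (j + z.1) ^ (1 + 2 * κ) * Z (j + z.1) z.2 else 0) := by
      intro z
      by_cases hz : z ∈ T j ∧ z.2 ∈ M (j + z.1)
      · have hW : W j z = ENNReal.ofReal 4 ^ t * ρ (j + z.1) ^ t :=
          Set.indicator_of_mem (s := {z | z ∈ T j ∧ z.2 ∈ M (j + z.1)}) hz _
        rw [hW, Set.indicator_of_mem hz.1, if_pos hz.2, mul_assoc]
        gcongr
        refine (hvol _ _).trans ?_
        gcongr
        rw [ENNReal.rpow_add _ _ (hρ0 _) (hρt _), mul_comm]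
        gcongr
        rw [hρq]
        exact pow_le_pow_right_of_le_one' hq1.le (Nat.le_add_right _ _)
      · have hW : W j z = 0 :=
          Set.indicator_of_notMem (s := {z | z ∈ T j ∧ z.2 ∈ M (j + z.1)}) hz _
        rw [hW, zero_mul]
        exact zero_le
    -- Here membership in the cover is dropped: each scale is summed over all of `M`, leaving a
    -- geometric series in `q`.
    have hsecond : ∑' z : ℕ × ℤ × ℤ, (if z.2 ∈ M (j + z.1) then
        ρ (j + z.1) ^ (1 + 2 * κ) * Z (j + z.1) z.2 else 0) ≤ K * (1 - q)⁻¹ * q ^ j := by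
      rw [ENNReal.tsum_prod']
      have inner : ∀ i : ℕ, ∑' m : ℤ × ℤ, (if m ∈ M (j + i) then
          ρ (j + i) ^ (1 + 2 * κ) * Z (j + i) m else 0) ≤ K * q ^ j * q ^ i := by
        intro i
        rw [tsum_eq_sum (s := M (j + i)) fun m hm => if_neg hm,
          Finset.sum_congr rfl fun m hm => if_pos hm, ← Finset.mul_sum]
        refine (mul_le_mul_right (hZ (j + i) (by omega)) _).trans (le_of_eq ?_)
        rw [mul_left_comm, ← ENNReal.rpow_add _ _ (hρ0 _) (hρt _), mul_assoc, ← pow_add, ← hρq]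
        congr 2
        ring
      refine (ENNReal.tsum_le_tsum inner).trans (le_of_eq ?_)
      rw [ENNReal.tsum_mul_left, ENNReal.tsum_geometric]
      ring
    rw [e]
    calc _ ≤ _ := ENNReal.tsum_le_tsum pt
      _ = ENNReal.ofReal 4 ^ t * (q ^ j * (∑' z, (T j).indicator
          (fun z => ENNReal.ofReal ((1 / 2) ^ (j + z.1)) ^ σ) z) +
          ∑' z : ℕ × ℤ × ℤ, if z.2 ∈ M (j + z.1) then
            ρ (j + z.1) ^ (1 + 2 * κ) * Z (j + z.1) z.2 else 0) := by
        rw [ENNReal.tsum_mul_left, ENNReal.tsum_add, ENNReal.tsum_mul_left]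
      _ ≤ ENNReal.ofReal 4 ^ t * (q ^ j * (ENNReal.ofReal 8 ^ σ * 3) +
          K * (1 - q)⁻¹ * q ^ j) := by
        gcongr
        exact hTsum j
      _ = _ := by rw [hD]; ring
  have hlim : Filter.Tendsto (fun j => ∫⁻ x, F j x) Filter.atTop (nhds 0) := by
    have h1 : Filter.Tendsto (fun j : ℕ => D * q ^ j) Filter.atTop (nhds 0) := by
      have := ENNReal.Tendsto.const_mul (a := D)
        (ENNReal.tendsto_pow_atTop_nhds_zero_of_lt_one hq1) (Or.inr hDtop)
      rwa [mul_zero] at this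
    exact tendsto_of_tendsto_of_tendsto_of_le_of_le' tendsto_const_nhds h1
      (Filter.Eventually.of_forall fun _ => zero_le) (Filter.eventually_atTop.2 ⟨k₀, hFint⟩)
  -- Fatou's lemma: the cover may vary with `j`, and only a lower limit is needed to bound `μH[t]`.
  have hzero : ∫⁻ x, Filter.liminf (fun j => F j x) Filter.atTop = 0 :=
    le_antisymm ((lintegral_liminf_le hFm).trans_eq hlim.liminf_eq) zero_le
  rw [lintegral_eq_zero_iff (Measurable.liminf hFm)] at hzero
  filter_upwards [hzero] with x hx hxB
  let A : ℕ → ℕ × ℤ × ℤ → Set (EuclideanSpace ℝ (Fin 2)) := fun j z =>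
    if z ∈ T j ∧ z.2 ∈ M (j + z.1) ∧ x ∈ S (j + z.1) z.2 then gridSquare ((1 / 2) ^ (j + z.1)) z.2
    else ∅
  have hdiam : ∀ j z, Metric.ediam (A j z) ≤ ENNReal.ofReal 4 * ρ (j + z.1) := by
    intro j z
    simp only [A]
    split_ifs
    · refine (ediam_gridSquare_le _ _).trans (le_of_eq ?_)
      rw [ENNReal.ofReal_mul (by norm_num)]
    · simp
  have hdiam' : ∀ j z, Metric.ediam (A j z) ^ t ≤
      W j z * (S (j + z.1) z.2).indicator 1 x := by
    intro j z
    by_cases hz : z ∈ T j ∧ z.2 ∈ M (j + z.1) ∧ x ∈ S (j + z.1) z.2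
    · have hW : W j z = ENNReal.ofReal 4 ^ t * ρ (j + z.1) ^ t :=
        Set.indicator_of_mem (s := {z | z ∈ T j ∧ z.2 ∈ M (j + z.1)}) ⟨hz.1, hz.2.1⟩ _
      rw [hW, Set.indicator_of_mem hz.2.2, Pi.one_apply, mul_one,
        ← ENNReal.mul_rpow_of_nonneg _ _ ht0.le]
      exact ENNReal.rpow_le_rpow (hdiam j z) ht0.le
    · simp only [A, if_neg hz]
      rw [Metric.ediam_empty, ENNReal.zero_rpow_of_pos ht0]
      exact zero_le
  have hρlim : Filter.Tendsto (fun j => ENNReal.ofReal 4 * ρ j) Filter.atTop (nhds 0) := by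
    have h1 : Filter.Tendsto ρ Filter.atTop (nhds 0) := by
      rw [← ENNReal.ofReal_zero]
      exact ENNReal.tendsto_ofReal
        (tendsto_pow_atTop_nhds_zero_of_lt_one (by norm_num) (by norm_num))
    have := ENNReal.Tendsto.const_mul (a := ENNReal.ofReal 4) h1 (Or.inr ofReal_ne_top)
    rwa [mul_zero] at this
  have hH := Measure.hausdorffMeasure_le_liminf_tsum t (visiblePart Γ x ∩ {u | h₁ + c ≤ u 1})
    (fun j => ENNReal.ofReal 4 * ρ j) hρlim A
    (Filter.Eventually.of_forall fun j z => (hdiam j z).trans (by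
      rw [hρadd]
      gcongr
      exact mul_le_of_le_one_right zero_le (hρ1 _)))
    (Filter.Eventually.of_forall fun j u hu => by
      obtain ⟨z, hzT, hzu⟩ := hTcov j u hu.1.1
      refine Set.mem_iUnion.2 ⟨z, ?_⟩
      have : z ∈ T j ∧ z.2 ∈ M (j + z.1) ∧ x ∈ S (j + z.1) z.2 :=
        ⟨hzT, hM _ _ u hu.1.1 hu.2 hzu, hxB, mem_sightSet_of_mem_visiblePart hu.1 hzu⟩
      simp only [A, if_pos this]
      exact hzu)
  refine le_antisymm (hH.trans ?_) zero_le
  rw [Pi.zero_apply] at hx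
  rw [← hx]
  exact Filter.liminf_le_liminf
    (Filter.Eventually.of_forall fun j => ENNReal.tsum_le_tsum (hdiam' j))

/-! ### All viewpoints and all directions -/

/-- Rational corners and gaps `1 / (n + 1)` reduce everything above `x` to countably many instances
of the one-box result, so the exceptional null sets can be united. -/
theorem exists_rat_openBox {Γ : Set (EuclideanSpace ℝ (Fin 2))} (hΓ : IsClosed Γ)
    {x u : EuclideanSpace ℝ (Fin 2)} (hx : x ∉ Γ) (hxu : x 1 < u 1) :
    ∃ (z : ℚ × ℚ × ℚ × ℚ) (n : ℕ), (z.2.1 - z.1 : ℝ) ≤ 1 ∧ (z.2.2.2 - z.2.2.1 : ℝ) ≤ 1 ∧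
      Disjoint Γ (openBox z.1 z.2.1 z.2.2.1 z.2.2.2) ∧
      x ∈ openBox z.1 z.2.1 z.2.2.1 z.2.2.2 ∧ z.2.2.2 + 1 / (n + 1 : ℝ) ≤ u 1 := by
  obtain ⟨δ, hδ, hball⟩ := Metric.isOpen_iff.1 hΓ.isOpen_compl x hx
  set η : ℝ := min (δ / 2) (min (1 / 2) (u 1 - x 1)) with hη
  have hη0 : 0 < η := by
    refine lt_min (by linarith) (lt_min (by norm_num) (by linarith))
  have hη1 : η ≤ δ / 2 := min_le_left _ _
  have hη2 : η ≤ 1 / 2 := (min_le_right _ _).trans (min_le_left _ _)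
  have hη3 : η ≤ u 1 - x 1 := (min_le_right _ _).trans (min_le_right _ _)
  obtain ⟨a, ha1, ha2⟩ := exists_rat_btwn (show x 0 - η < x 0 by linarith)
  obtain ⟨b, hb1, hb2⟩ := exists_rat_btwn (show x 0 < x 0 + η by linarith)
  obtain ⟨h₀, hh1, hh2⟩ := exists_rat_btwn (show x 1 - η < x 1 by linarith)
  obtain ⟨h₁, hk1, hk2⟩ := exists_rat_btwn (show x 1 < x 1 + η by linarith)
  obtain ⟨n, hn⟩ := exists_nat_one_div_lt (show 0 < u 1 - h₁ by linarith)
  refine ⟨(a, b, h₀, h₁), n, by simp only; linarith, by simp only; linarith, ?_,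
    ⟨⟨ha2, hb1⟩, ⟨hh2, hk1⟩⟩, by simp only; linarith⟩
  rw [Set.disjoint_left]
  rintro p hp ⟨⟨p1, p2⟩, ⟨p3, p4⟩⟩
  simp only at p1 p2 p3 p4
  refine hball (?_ : p ∈ Metric.ball x δ) hp
  have h0 : |p 0 - x 0| < δ / 2 := abs_lt.2 ⟨by linarith, by linarith⟩
  have h1 : |p 1 - x 1| < δ / 2 := abs_lt.2 ⟨by linarith, by linarith⟩
  exact (EuclideanSpace.dist_le_abs_add_abs p x).trans_lt (by linarith)

theorem ae_hausdorffMeasure_visiblePart_above_eq_zero {Γ : Set (EuclideanSpace ℝ (Fin 2))}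
    (hcomp : IsCompact Γ) (hconn : IsPreconnected Γ) {σ κ t : ℝ} (hσ : 1 ≤ σ)
    (hκ : 0 < κ) (hκ1 : κ ≤ 1) (ht : 2 * t = σ + 1 + 3 * κ) (hΓ : μH[σ] Γ = 0) :
    ∀ᵐ x : EuclideanSpace ℝ (Fin 2), x ∉ Γ → μH[t] (visiblePart Γ x ∩ {u | x 1 < u 1}) = 0 := by
  have key : ∀ᵐ x : EuclideanSpace ℝ (Fin 2), ∀ (z : ℚ × ℚ × ℚ × ℚ) (n : ℕ),
      (z.2.1 - z.1 : ℝ) ≤ 1 → (z.2.2.2 - z.2.2.1 : ℝ) ≤ 1 →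
      Disjoint Γ (openBox z.1 z.2.1 z.2.2.1 z.2.2.2) → x ∈ openBox z.1 z.2.1 z.2.2.1 z.2.2.2 →
      μH[t] (visiblePart Γ x ∩ {u | z.2.2.2 + 1 / (n + 1 : ℝ) ≤ u 1}) = 0 := by
    simp only [ae_all_iff, Filter.eventually_imp_distrib_left]
    intro z n h1 h2 h3
    exact ae_openBox_hausdorffMeasure_visiblePart_eq_zero hcomp hconn h1 h2 h3
      Nat.one_div_pos_of_nat hσ hκ hκ1 ht hΓ
  filter_upwards [key] with x hx hxΓ
  have hcov : visiblePart Γ x ∩ {u | x 1 < u 1} ⊆ ⋃ (z : ℚ × ℚ × ℚ × ℚ) (n : ℕ)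
      (_ : (z.2.1 - z.1 : ℝ) ≤ 1) (_ : (z.2.2.2 - z.2.2.1 : ℝ) ≤ 1)
      (_ : Disjoint Γ (openBox z.1 z.2.1 z.2.2.1 z.2.2.2))
      (_ : x ∈ openBox z.1 z.2.1 z.2.2.1 z.2.2.2),
      visiblePart Γ x ∩ {u | z.2.2.2 + 1 / (n + 1 : ℝ) ≤ u 1} := by
    rintro u ⟨hu, hxu⟩
    obtain ⟨z, n, h1, h2, h3, h4, h5⟩ := exists_rat_openBox hcomp.isClosed hxΓ hxu
    simp only [Set.mem_iUnion]
    exact ⟨z, n, h1, h2, h3, h4, hu, h5⟩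
  refine measure_mono_null hcov ?_
  simp only [measure_iUnion_null_iff]
  exact hx

theorem visiblePart_image (e : EuclideanSpace ℝ (Fin 2) ≃ₗᵢ[ℝ] EuclideanSpace ℝ (Fin 2))
    (Γ : Set (EuclideanSpace ℝ (Fin 2))) (x : EuclideanSpace ℝ (Fin 2)) :
    visiblePart (e '' Γ) (e x) = e '' visiblePart Γ x := by
  have hseg : ∀ u, segment ℝ (e x) (e u) = e '' segment ℝ x u := fun u =>
    (image_segment ℝ e.toLinearEquiv.toLinearMap.toAffineMap x u).symm
  ext v
  obtain ⟨u, rfl⟩ := e.surjective v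
  rw [e.injective.mem_set_image]
  change (e u ∈ e '' Γ ∧ segment ℝ (e x) (e u) ∩ e '' Γ = {e u}) ↔ _
  rw [e.injective.mem_set_image, hseg, ← Set.image_inter e.injective, ← Set.image_singleton,
    (Set.image_injective.2 e.injective).eq_iff]
  rfl

/-- Linear isometries preserve visibility, `μH[t]` and Lebesgue null sets. The identity, negation,
the coordinate swap and its negative yield the four sides of `x`, which cover every point other than
`x`. -/
theorem ae_hausdorffMeasure_visiblePart_side_eq_zero {Γ : Set (EuclideanSpace ℝ (Fin 2))}
    (hcomp : IsCompact Γ) (hconn : IsPreconnected Γ) {σ κ t : ℝ} (hσ : 1 ≤ σ)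
    (hκ : 0 < κ) (hκ1 : κ ≤ 1) (ht : 2 * t = σ + 1 + 3 * κ) (hΓ : μH[σ] Γ = 0)
    (e : EuclideanSpace ℝ (Fin 2) ≃ₗᵢ[ℝ] EuclideanSpace ℝ (Fin 2)) :
    ∀ᵐ x : EuclideanSpace ℝ (Fin 2), x ∉ Γ →
      μH[t] (visiblePart Γ x ∩ {u | e x 1 < e u 1}) = 0 := by
  have h := ae_hausdorffMeasure_visiblePart_above_eq_zero (hcomp.image e.continuous)
    (hconn.image e e.continuous.continuousOn) hσ hκ hκ1 ht
    (by rw [e.isometry.hausdorffMeasure_image (Or.inl (by linarith)), hΓ])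
  filter_upwards [e.measurePreserving.quasiMeasurePreserving.ae h] with x hx hxΓ
  have := hx (fun hmem => hxΓ ((e.injective.mem_set_image).1 hmem))
  rw [visiblePart_image] at this
  have hsub : e '' (visiblePart Γ x ∩ {u | e x 1 < e u 1}) ⊆
      e '' visiblePart Γ x ∩ {u | e x 1 < u 1} := by
    rintro _ ⟨u, ⟨hu, hlt⟩, rfl⟩
    exact ⟨⟨u, hu, rfl⟩, hlt⟩
  have h0 := measure_mono_null hsub this
  rwa [e.isometry.hausdorffMeasure_image (Or.inl (by linarith))] at h0

theorem ae_hausdorffMeasure_visiblePart_eq_zero {Γ : Set (EuclideanSpace ℝ (Fin 2))}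
    (hcomp : IsCompact Γ) (hconn : IsPreconnected Γ) {σ κ t : ℝ} (hσ : 1 ≤ σ)
    (hκ : 0 < κ) (hκ1 : κ ≤ 1) (ht : 2 * t = σ + 1 + 3 * κ) (hΓ : μH[σ] Γ = 0) :
    ∀ᵐ x : EuclideanSpace ℝ (Fin 2), x ∉ Γ → μH[t] (visiblePart Γ x) = 0 := by
  let swap : EuclideanSpace ℝ (Fin 2) ≃ₗᵢ[ℝ] EuclideanSpace ℝ (Fin 2) :=
    LinearIsometryEquiv.piLpCongrLeft 2 ℝ ℝ (Equiv.swap 0 1)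
  have hswap : ∀ x, swap x 1 = x 0 := fun x => by
    simp [swap, LinearIsometryEquiv.piLpCongrLeft_apply, Equiv.piCongrLeft'_apply]
  have side := ae_hausdorffMeasure_visiblePart_side_eq_zero hcomp hconn hσ hκ hκ1 ht hΓ
  filter_upwards [side (LinearIsometryEquiv.refl ℝ _), side (LinearIsometryEquiv.neg ℝ),
    side swap, side (swap.trans (LinearIsometryEquiv.neg ℝ))] with x h1 h2 h3 h4 hx
  refine measure_mono_null (fun u hu => ?_) (measure_union_null (measure_union_null (h1 hx) (h2 hx))
    (measure_union_null (h3 hx) (h4 hx)))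
  have hne : u ≠ x := fun h => hx (h ▸ hu.1)
  have hcoord : u 0 ≠ x 0 ∨ u 1 ≠ x 1 := by
    by_contra hcon
    push Not at hcon
    refine hne ?_
    ext i
    fin_cases i
    · exact hcon.1
    · exact hcon.2
  rcases hcoord with h | h
  · refine Or.inr ?_
    rcases lt_or_gt_of_ne h with h | h
    · exact Or.inr ⟨hu, by simpa [hswap] using h⟩
    · exact Or.inl ⟨hu, by simpa [hswap] using h⟩
  · refine Or.inl ?_
    rcases lt_or_gt_of_ne h with h | h
    · exact Or.inr ⟨hu, by simpa using h⟩
    · exact Or.inl ⟨hu, by simpa using h⟩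

/-! ### Dimension bounds -/

/-- A viewpoint in `Γ` blocks every other point. This settles the viewpoints in `Γ`, which may have
positive measure. -/
theorem dimH_visiblePart_of_mem {Γ : Set (EuclideanSpace ℝ (Fin 2))}
    {x : EuclideanSpace ℝ (Fin 2)} (hx : x ∈ Γ) : dimH (visiblePart Γ x) = 0 := by
  refine Set.Subsingleton.dimH_zero fun u hu v hv => ?_
  have key : ∀ w ∈ visiblePart Γ x, x = w := fun w hw => by
    have : x ∈ segment ℝ x w ∩ Γ := ⟨left_mem_segment ℝ x w, hx⟩
    rw [hw.2] at this
    exact this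
  exact (key u hu).symm.trans (key v hv)

/-- Almost every visible part of a planar continuum of dimension `s ≥ 1` has dimension at most
`(s + 1) / 2`. -/
theorem ae_dimH_visiblePart_le {Γ : Set (EuclideanSpace ℝ (Fin 2))}
    (hcomp : IsCompact Γ) (hconn : IsPreconnected Γ) (hdim : 1 ≤ dimH Γ) (hfin : dimH Γ ≠ ⊤) :
    ∀ᵐ x : EuclideanSpace ℝ (Fin 2),
      dimH (visiblePart Γ x) ≤ ENNReal.ofReal (((dimH Γ).toReal + 1) / 2) := by
  set s := (dimH Γ).toReal with hs
  have hs1 : 1 ≤ s := by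
    have := ENNReal.toReal_mono hfin hdim
    simpa using this
  have hdims : dimH Γ = ENNReal.ofReal s := (ENNReal.ofReal_toReal hfin).symm
  have key : ∀ᵐ x : EuclideanSpace ℝ (Fin 2), ∀ n : ℕ, x ∉ Γ →
      μH[(s + 1) / 2 + 2 * (1 / (n + 1 : ℝ))] (visiblePart Γ x) = 0 := by
    rw [ae_all_iff]
    intro n
    have hκ : (0 : ℝ) < 1 / (n + 1 : ℝ) := Nat.one_div_pos_of_nat
    have hκ1 : 1 / (n + 1 : ℝ) ≤ 1 := by
      rw [div_le_one (by positivity)]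
      linarith [(Nat.cast_nonneg n : (0 : ℝ) ≤ n)]
    -- With `κ = 1 / (n + 1)` and `σ = s + κ`, the relation `2 * t = σ + 1 + 3 * κ` gives `t = (s +
    -- 1) / 2 + 2 * κ`.
    refine ae_hausdorffMeasure_visiblePart_eq_zero hcomp hconn (σ := s + 1 / (n + 1 : ℝ))
      (by linarith) hκ hκ1 (by ring) ?_
    have := hausdorffMeasure_of_dimH_lt (s := Γ) (d := Real.toNNReal (s + 1 / (n + 1 : ℝ))) (by
      rw [hdims]
      exact (ENNReal.ofReal_lt_ofReal_iff (by linarith)).2 (by linarith))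
    rwa [Real.coe_toNNReal _ (by linarith)] at this
  filter_upwards [key] with x hx
  by_cases hxΓ : x ∈ Γ
  · rw [dimH_visiblePart_of_mem hxΓ]
    exact zero_le
  · have hle : ∀ n : ℕ, dimH (visiblePart Γ x) ≤
        ENNReal.ofReal ((s + 1) / 2 + 2 * (1 / (n + 1 : ℝ))) := by
      intro n
      refine dimH_le_of_hausdorffMeasure_ne_top
        (d := Real.toNNReal ((s + 1) / 2 + 2 * (1 / (n + 1 : ℝ)))) ?_
      rw [Real.coe_toNNReal _ (by positivity), hx n hxΓ]
      exact zero_ne_top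
    refine ge_of_tendsto' (x := Filter.atTop) (ENNReal.tendsto_ofReal ?_) hle
    have := (tendsto_one_div_add_atTop_nhds_zero_nat (𝕜 := ℝ)).const_mul 2 |>.const_add
      ((s + 1) / 2)
    simpa using this

theorem theorem1 (Γ : Set (EuclideanSpace ℝ (Fin 2))) (hcompact : IsCompact Γ)
    (hconn : IsConnected Γ) (hdim : 1 < dimH Γ) :
    ∀ᵐ x ∂(MeasureTheory.volume : MeasureTheory.Measure (EuclideanSpace ℝ (Fin 2))),
      dimH (visiblePart Γ x) ≤ ENNReal.ofReal (1 / 2 + Real.sqrt ((dimH Γ).toReal - 3 / 4)) := by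
  have h2 : dimH Γ ≤ 2 := by
    have := (dimH_mono (Set.subset_univ Γ)).trans_eq
      (Real.dimH_univ_eq_finrank (EuclideanSpace ℝ (Fin 2)))
    simpa using this
  have hfin : dimH Γ ≠ ⊤ := ne_top_of_le_ne_top (by norm_num) h2
  have hs2 : (dimH Γ).toReal ≤ 2 := by
    have := ENNReal.toReal_mono (by norm_num) h2
    simpa using this
  have hs1 : 1 ≤ (dimH Γ).toReal := by
    have := ENNReal.toReal_mono hfin hdim.le
    simpa using this
  filter_upwards [ae_dimH_visiblePart_le hcompact hconn.isPreconnected hdim.le hfin] with x hx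
  refine hx.trans (ENNReal.ofReal_le_ofReal ?_)
  -- After squaring, this is `(s - 1) * (s - 3) ≤ 0`.
  have : (dimH Γ).toReal / 2 ≤ Real.sqrt ((dimH Γ).toReal - 3 / 4) :=
    Real.le_sqrt_of_sq_le (by nlinarith)
  linarith
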